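/- Let $A\in\mathbb R^{n\times n}$, $B\in\mathbb R^{n\times m}$, $C\in\mathbb R^{k\times n}$, let the pair $\{A,C\}$ be observable, and let $\tilde n\ge 1$ be the minimal natural number such that the stacked matrix with block rows $C, CA,\dots,CA^{\tilde n-1}$ has rank $n$. A square matrix is called anti-Hurwitz if all its eigenvalues have positive real parts. **1)** The linear algebraic equation $$AG_0-G_0A+Y_0C=A,\qquad CG_0=\mathbf 0$$ has a solution $Y_0\in\mathbb R^{n\times k}$, $G_0\in\mathbb R^{n\times n}$ such that a) the matrix $G_{\mathbf d}=I_n+\nu G_0$ is anti-Hurwitz for every real $\nu\ge -1/\tilde n$; b) the matrix $I_n+G_0$ is invertible, and $A_0=A-(I_n+G_0)^{-1}Y_0C$ satisfies $A_0G_{\mathbf d}=(G_{\mathbf d}+\nu I_n)A_0$ and $CG_{\mathbf d}=C$ for every $\nu\in\mathbb R$. Moreover, for every solution $(G_0,Y_0)$ with the properties a) and b), every $\nu\ge-1/\tilde n$ and every $\rho>0$, the following holds. **2)** The linear matrix inequality $$PA_0+A_0^\top P+YC+C^\top Y^\top+\rho(PG_{\mathbf d}+G_{\mathbf d}^\top P)\preceq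 0,\qquad PG_{\mathbf d}+G_{\mathbf d}^\top P\succ0,\qquad P=P^\top\succ0$$ has a solution $P\in\mathbb R^{n\times n}$, $Y\in\mathbb R^{n\times k}$. **3)** $\mathbf d(s)=e^{sG_{\mathbf d}}$ and $\tilde{\mathbf d}(s)=\begin{pmatrix}\mathbf d(s)&\mathbf 0\\ \mathbf 0&e^s\end{pmatrix}$, $s\in\mathbb R$, are dilations in $\mathbb R^n$ and $\mathbb R^{n+1}$ (continuous one-parameter groups of linear maps such that the norm of the image of every nonzero vector tends to $+\infty$ as $s\to+\infty$ and to $0$ as $s\to-\infty$), and for every $L\in\mathbb R^{n\times k}$ the error equation $$\frac{d}{dt}\begin{pmatrix}\varepsilon\\ \xi\end{pmatrix}=g_\xi(\varepsilon,\xi):=\begin{pmatrix}A_0\varepsilon+|\xi|^{\nu-1}\mathbf d(\ln|\xi|)LC\varepsilon\\ -\rho|\xi|^{\nu+1}\mathrm{sign}(\xi)\end{pmatrix}$$ is $\tilde{\mathbf d}$-homogeneous of degree $\nu$: $g_\xi(\tilde{\mathbf d}(s)\varepsilon_\xi)=e^{\nu s}\tilde{\mathbf d}(s)g_\xi(\varepsilon_\xi)$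 for all $s\in\mathbb R$ and all $\varepsilon_\xi=(\varepsilon,\xi)\in\mathbb R^{n+1}$ with $\xi\ne0$. **4)** Let $(P,Y)$ be any solution of the linear matrix inequality in 2), let $L_0=-(I_n+G_0)^{-1}Y_0$ and $L=P^{-1}Y$, and let $\xi_0\ne0$. Put $T_0=+\infty$ if $\nu\ge0$ and $T_0=\dfrac{|\xi_0|^{-\nu}}{-\nu\rho}<+\infty$ if $\nu<0$. Let $x$ be a solution of $\dot x=Ax+Bu$ on $[0,T_0)$ with an input $u$, and let $y=Cx$. Then for every $z_0\in\mathbb R^n$ the observer $$\dot z=Az+Bu+\bigl(L_0+|\xi|^{\nu-1}\mathbf d(\ln|\xi|)L\bigr)(Cz-y),\qquad \dot\xi=-\rho|\xi|^{1+\nu}\mathrm{sign}(\xi),\qquad z(0)=z_0,\quad \xi(0)=\xi_0,$$ has a solution on $[0,T_0)$, and for every such solution the error $\varepsilon_\xi=(z-x,\xi)$ satisfies $\varepsilon_\xi(t)\to\mathbf 0$ as $t\to T_0$; thus the error converges to zero in the fixed time $T_0<+\infty$ if $\nu<0$ and asymptotically ($T_0=+\infty$) if $\nu\ge0$. Solutions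 are understood in the Carathéodory sense (integral equations with locally integrable right-hand sides). -/

import Mathlib

open Matrix MeasureTheory Filter Topology

noncomputable section

/-- The stacked matrix with block rows `C, C A, …, C A^(N-1)`. -/
def obsMatrix {n k : ℕ} (A : Matrix (Fin n) (Fin n) ℝ) (C : Matrix (Fin k) (Fin n) ℝ) (N : ℕ) :
    Matrix (Fin N × Fin k) (Fin n) ℝ :=
  Matrix.of fun p j => (C * A ^ (p.1 : ℕ)) p.2 j

/-- The pair `{A, C}` is observable (Kalman rank condition). -/
def ObservablePair {n k : ℕ} (A : Matrix (Fin n) (Fin n) ℝ) (C : Matrix (Fin k) (Fin n) ℝ) : Prop :=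
  (obsMatrix A C n).rank = n

/-- `N` is the minimal number of blocks (at least one) for which the stacked matrix has rank `n`. -/
def IsObsIndex {n k : ℕ} (A : Matrix (Fin n) (Fin n) ℝ) (C : Matrix (Fin k) (Fin n) ℝ)
    (N : ℕ) : Prop :=
  IsLeast {M : ℕ | 1 ≤ M ∧ (obsMatrix A C M).rank = n} N

/-- All (complex) eigenvalues have positive real part. -/
def AntiHurwitz {n : ℕ} (G : Matrix (Fin n) (Fin n) ℝ) : Prop :=
  ∀ μ ∈ spectrum ℂ (G.map Complex.ofReal), 0 < μ.re

/-- The generator `G_d = I + ν G₀`. -/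
def genD {n : ℕ} (G₀ : Matrix (Fin n) (Fin n) ℝ) (ν : ℝ) : Matrix (Fin n) (Fin n) ℝ :=
  1 + ν • G₀

/-- The static gain `L₀ = -(I + G₀)⁻¹ Y₀`. -/
def gainL₀ {n k : ℕ} (G₀ : Matrix (Fin n) (Fin n) ℝ) (Y₀ : Matrix (Fin n) (Fin k) ℝ) :
    Matrix (Fin n) (Fin k) ℝ :=
  -((1 + G₀)⁻¹ * Y₀)

/-- `A₀ = A - (I + G₀)⁻¹ Y₀ C`. -/
def matA₀ {n k : ℕ} (A : Matrix (Fin n) (Fin n) ℝ) (C : Matrix (Fin k) (Fin n) ℝ)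
    (G₀ : Matrix (Fin n) (Fin n) ℝ) (Y₀ : Matrix (Fin n) (Fin k) ℝ) : Matrix (Fin n) (Fin n) ℝ :=
  A - (1 + G₀)⁻¹ * Y₀ * C

/-- `(G₀, Y₀)` solves the linear algebraic equation and has the two listed properties, where `N`
stands for the minimal number of blocks of the observability matrix. -/
structure IsHomogenizing {n k : ℕ} (A : Matrix (Fin n) (Fin n) ℝ) (C : Matrix (Fin k) (Fin n) ℝ)
    (N : ℕ) (G₀ : Matrix (Fin n) (Fin n) ℝ) (Y₀ : Matrix (Fin n) (Fin k) ℝ) : Prop where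
  eqn : A * G₀ - G₀ * A + Y₀ * C = A
  eqnC : C * G₀ = 0
  antiHurwitz : ∀ ν : ℝ, -1 / (N : ℝ) ≤ ν → AntiHurwitz (genD G₀ ν)
  invertible : IsUnit (1 + G₀)
  homA₀ : ∀ ν : ℝ, matA₀ A C G₀ Y₀ * genD G₀ ν =
    (genD G₀ ν + ν • (1 : Matrix (Fin n) (Fin n) ℝ)) * matA₀ A C G₀ Y₀
  homC : ∀ ν : ℝ, C * genD G₀ ν = C

/-- The linear matrix inequality in the unknowns `P`, `Y`
(`PosDef` contains the symmetry of the matrix). -/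
structure SolvesLMI {n k : ℕ} (A₀ : Matrix (Fin n) (Fin n) ℝ) (C : Matrix (Fin k) (Fin n) ℝ)
    (G : Matrix (Fin n) (Fin n) ℝ) (ρ : ℝ) (P : Matrix (Fin n) (Fin n) ℝ)
    (Y : Matrix (Fin n) (Fin k) ℝ) : Prop where
  lmi : (-(P * A₀ + A₀ᵀ * P + Y * C + Cᵀ * Yᵀ + ρ • (P * G + Gᵀ * P))).PosSemidef
  monotone : (P * G + Gᵀ * P).PosDef
  posDef : P.PosDef

/-- The continuous linear group `s ↦ exp (s G)`. -/
def expGroup {n : ℕ} (G : Matrix (Fin n) (Fin n) ℝ) (s : ℝ) : Matrix (Fin n) (Fin n) ℝ :=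
  NormedSpace.exp (s • G)

/-- The block-diagonal family `diag (exp (s G), e^s)`. -/
def extGroup {n : ℕ} (G : Matrix (Fin n) (Fin n) ℝ) (s : ℝ) :
    Matrix (Fin n ⊕ Unit) (Fin n ⊕ Unit) ℝ :=
  Matrix.fromBlocks (expGroup G s) 0 0 (Real.exp s • (1 : Matrix Unit Unit ℝ))

/-- A continuous linear dilation in `ℝ^ι`. -/
structure IsDilation {ι : Type*} [Fintype ι] [DecidableEq ι] (d : ℝ → Matrix ι ι ℝ) : Prop where
  zero : d 0 = 1
  add : ∀ s t : ℝ, d (s + t) = d s * d t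
  continuous : Continuous d
  expand : ∀ x : ι → ℝ, x ≠ 0 → Tendsto (fun s => ‖d s *ᵥ x‖) atTop atTop
  contract : ∀ x : ι → ℝ, x ≠ 0 → Tendsto (fun s => ‖d s *ᵥ x‖) atBot (𝓝 0)

/-- `f` is `d`-homogeneous of degree `μ` at the points of `S`. -/
def IsHomogeneousOn {ι : Type*} [Fintype ι] (d : ℝ → Matrix ι ι ℝ) (f : (ι → ℝ) → (ι → ℝ))
    (μ : ℝ) (S : Set (ι → ℝ)) : Prop :=
  ∀ s : ℝ, ∀ x ∈ S, d s *ᵥ x ∈ S ∧ f (d s *ᵥ x) = Real.exp (μ * s) • (d s *ᵥ f x)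

/-- The time-varying gain `|ξ|^(ν-1) d(ln |ξ|) L`, for `ξ ≠ 0`. -/
def gain {n k : ℕ} (G : Matrix (Fin n) (Fin n) ℝ) (L : Matrix (Fin n) (Fin k) ℝ) (ν ξ : ℝ) :
    Matrix (Fin n) (Fin k) ℝ :=
  |ξ| ^ (ν - 1) • (expGroup G (Real.log |ξ|) * L)

/-- Right-hand side of the equation `ξ' = -ρ |ξ|^(1+ν) sign ξ`. -/
def xiField (ρ ν ξ : ℝ) : ℝ := -ρ * |ξ| ^ (1 + ν) * Real.sign ξ

/-- The vector field of the extended error equation in the variable `(ε, ξ)`. -/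
def errorField {n k : ℕ} (A₀ : Matrix (Fin n) (Fin n) ℝ) (C : Matrix (Fin k) (Fin n) ℝ)
    (G : Matrix (Fin n) (Fin n) ℝ) (L : Matrix (Fin n) (Fin k) ℝ) (ρ ν : ℝ)
    (e : Fin n ⊕ Unit → ℝ) : Fin n ⊕ Unit → ℝ :=
  let ε : Fin n → ℝ := fun i => e (Sum.inl i)
  let ξ : ℝ := e (Sum.inr ())
  Sum.elim (A₀ *ᵥ ε + gain G L ν ξ *ᵥ (C *ᵥ ε)) (fun _ => xiField ρ ν ξ)

/-- `w` is a (Carathéodory) solution of `w' = f(t, w)` on the time interval `J` with left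
end point `0 ∈ J`. -/
def IsSolutionOn {E : Type*} [NormedAddCommGroup E] [NormedSpace ℝ E] (J : Set ℝ)
    (f : ℝ → E → E) (w : ℝ → E) : Prop :=
  ∀ t ∈ J, IntervalIntegrable (fun s => f s (w s)) volume 0 t ∧
    w t = w 0 + ∫ s in (0 : ℝ)..t, f s (w s)

/-- `x` is a solution of the plant `x' = A x + B u`. -/
def IsPlantSolution {n m : ℕ} (A : Matrix (Fin n) (Fin n) ℝ) (B : Matrix (Fin n) (Fin m) ℝ)
    (J : Set ℝ) (u : ℝ → Fin m → ℝ) (x : ℝ → Fin n → ℝ) : Prop :=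
  IsSolutionOn J (fun t v => A *ᵥ v + B *ᵥ u t) x

/-- `(z, ξ)` is a solution of the observer with input `u` and measured output `y`. -/
def IsObserverSolution {n m k : ℕ} (A : Matrix (Fin n) (Fin n) ℝ) (B : Matrix (Fin n) (Fin m) ℝ)
    (C : Matrix (Fin k) (Fin n) ℝ) (G : Matrix (Fin n) (Fin n) ℝ)
    (L₀ L : Matrix (Fin n) (Fin k) ℝ) (ρ ν : ℝ) (J : Set ℝ)
    (u : ℝ → Fin m → ℝ) (y : ℝ → Fin k → ℝ) (z : ℝ → Fin n → ℝ) (ξ : ℝ → ℝ) : Prop :=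
  IsSolutionOn J
      (fun t v => A *ᵥ v + B *ᵥ u t + (L₀ + gain G L ν (ξ t)) *ᵥ (C *ᵥ v - y t)) z ∧
    IsSolutionOn J (fun _ v => xiField ρ ν v) ξ

/-- For `ν < 0`, the time `|ξ₀|^(-ν) / (-ν ρ)`. -/
def settlingTime (ρ ν ξ₀ : ℝ) : ℝ := |ξ₀| ^ (-ν) / (-ν * ρ)

/-- The interval `[0, T₀)`, where `T₀ = +∞` for `ν ≥ 0`. -/
def horizon (ρ ν ξ₀ : ℝ) : Set ℝ :=
  if ν < 0 then Set.Ico 0 (settlingTime ρ ν ξ₀) else Set.Ici 0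

/-- The filter `t → T₀`, `t < T₀`, where `T₀ = +∞` for `ν ≥ 0`. -/
def toHorizon (ρ ν ξ₀ : ℝ) : Filter ℝ :=
  if ν < 0 then 𝓝[<] settlingTime ρ ν ξ₀ else atTop

end

/-! The whole construction rests on one operator `G₀` that grades the state space along the
unobservable filtration F_j = {v : CAⁱv = 0 for i < j}. It acts as the scalar i on F_i/F_{i+1} and
satisfies G₀A = AG₀ - A on ker C. Such a `G₀` is built by downward recursion on the filtration
(`exists_grading_step`, `exists_grading`). The defect A + G₀A - AG₀ then vanishes on ker C, so it
equals Y₀C for some `Y₀`. The spectrum of I + νG₀ lies among the numbers 1 + νi with i < N, all at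
least 1/N when ν ≥ -1/N. The equation and CG₀ = 0 together give A₀G₀ = (I + G₀)A₀, from which the
homogeneity relations follow.

For an arbitrary solution with properties a) and b), the relation A₀G₀ = (I + G₀)A₀ shows that CA₀ʲ
is multiplied by 1 + νj when composed with `genD`. At ν = -1/N this factor vanishes for j = N while
`genD` is invertible, so CA₀ᴺ = 0. In the coordinates u_j = CA₀ʲx, injective by observability,
`genD` is therefore diagonal and A₀ is a nilpotent shift. An explicit block tridiagonal form
(`ladderMatrix`) with rapidly growing weights solves the inequality in
`IsHomogenizing.exists_solvesLMI`. The derivative along the shift is negative except for a multiple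
of |Cx|², which `Y` absorbs.

For convergence, ξ has an explicit modulus r(t), and ε = d(ln r)w turns the error equation into w' =
r^ν(A₀ + LC + ρG)w. The matrix inequality says exactly that wᵀPw does not increase, so w is bounded,
while d(ln r) contracts to zero as r → 0 (`tendsto_error`). The same substitution solves the error
equation by a matrix exponential (`exists_error_solution`). Uniqueness of ξ comes from monotonicity
of its field. -/

/-! ### Grading operators along the unobservable filtration. -/

section LinearAlgebra

variable {K V W U : Type*} [Field K] [AddCommGroup V] [Module K V] [AddCommGroup W] [Module K W]
  [AddCommGroup U] [Module K U]

/-- The subspace of vectors with vanishing outputs `c v, c (a v), …, c (a^(j-1) v)`. -/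
def unobservable (a : V →ₗ[K] V) (c : V →ₗ[K] W) : ℕ → Submodule K V
  | 0 => ⊤
  | j + 1 => LinearMap.ker c ⊓ (unobservable a c j).comap a

theorem mem_unobservable_succ {a : V →ₗ[K] V} {c : V →ₗ[K] W} {j : ℕ} {v : V} :
    v ∈ unobservable a c (j + 1) ↔ c v = 0 ∧ a v ∈ unobservable a c j := by
  simp [unobservable]

theorem unobservable_antitone (a : V →ₗ[K] V) (c : V →ₗ[K] W) :
    Antitone (unobservable a c) := by
  refine antitone_nat_of_succ_le fun j => ?_
  induction j with
  | zero => exact le_top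
  | succ j ih =>
    intro v hv
    rw [mem_unobservable_succ] at hv ⊢
    exact ⟨hv.1, ih hv.2⟩

theorem mem_unobservable_iff {a : V →ₗ[K] V} {c : V →ₗ[K] W} {j : ℕ} {v : V} :
    v ∈ unobservable a c j ↔ ∀ i < j, c ((a ^ i) v) = 0 := by
  induction j generalizing v with
  | zero => simp [unobservable]
  | succ j ih =>
    rw [mem_unobservable_succ, ih]
    constructor
    · rintro ⟨h0, h⟩ i hi
      cases i with
      | zero => simpa using h0
      | succ i => simpa [pow_succ] using h i (by omega)
    · intro h
      refine ⟨by simpa using h 0 (by omega), fun i hi => ?_⟩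
      simpa [pow_succ] using h (i + 1) (by omega)

/-- Choose a section of `f` onto its range, compose with `g`, and extend from the range to all of
`V`. This serves both to glue partially prescribed operators and to extract `Y₀`. -/
theorem LinearMap.exists_comp_eq_of_ker_le (f : U →ₗ[K] V) (g : U →ₗ[K] W)
    (h : LinearMap.ker f ≤ LinearMap.ker g) : ∃ q : V →ₗ[K] W, ∀ u, q (f u) = g u := by
  obtain ⟨s, hs⟩ := f.rangeRestrict.exists_rightInverse_of_surjective f.range_rangeRestrict
  obtain ⟨q, hq⟩ := LinearMap.exists_extend (g ∘ₗ s)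
  refine ⟨q, fun u => ?_⟩
  have h1 : q (f u) = g (s (f.rangeRestrict u)) := by
    simpa using LinearMap.congr_fun hq (f.rangeRestrict u)
  have h2 : f (s (f.rangeRestrict u)) = f u := by
    simpa using congrArg Subtype.val (LinearMap.congr_fun hs (f.rangeRestrict u))
  have h3 : s (f.rangeRestrict u) - u ∈ LinearMap.ker g := h (by simp [h2])
  rw [h1]
  simpa [sub_eq_zero] using h3

/-- One step of the construction of a grading operator along the unobservable filtration. -/
theorem exists_grading_step (a : V →ₗ[K] V) (c : V →ₗ[K] W) (j : ℕ) (g : V →ₗ[K] V)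
    (hg : ∀ i, j + 1 ≤ i → ∀ v ∈ unobservable a c i, g v - (i : K) • v ∈ unobservable a c (i + 1))
    (hga : ∀ v ∈ unobservable a c (j + 2), g (a v) = a (g v) - a v) :
    ∃ g' : V →ₗ[K] V,
      (∀ i, j ≤ i → ∀ v ∈ unobservable a c i, g' v - (i : K) • v ∈ unobservable a c (i + 1)) ∧
      ∀ v ∈ unobservable a c (j + 1), g' (a v) = a (g' v) - a v := by
  set F := unobservable a c with hF
  have anti : Antitone F := unobservable_antitone a c
  have aF : ∀ i, ∀ v ∈ F (i + 1), a v ∈ F i := fun i v hv => (mem_unobservable_succ.1 hv).2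
  -- The values on F (j+1) are kept, those on a(F (j+1)) are forced by the commutation rule, and on
  -- the rest of F j, inside `Q`, the scalar j is chosen freely. `Φ` adds up the three pieces and
  -- `Ψ` lists the prescribed values.
  obtain ⟨Q, hQ⟩ := Submodule.exists_isCompl (F (j + 1) ⊔ (F (j + 1)).map a)
  let Φ : (F (j + 1) × F (j + 1)) × (Q ⊓ F j : Submodule K V) →ₗ[K] V :=
    ((F (j + 1)).subtype.coprod (a ∘ₗ (F (j + 1)).subtype)).coprod (Q ⊓ F j).subtype
  let Ψ : (F (j + 1) × F (j + 1)) × (Q ⊓ F j : Submodule K V) →ₗ[K] V :=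
    ((g ∘ₗ (F (j + 1)).subtype).coprod ((a ∘ₗ g - a) ∘ₗ (F (j + 1)).subtype)).coprod
      ((j : K) • (Q ⊓ F j).subtype)
  have hΦ : ∀ v w q, Φ ((v, w), q) = v + a w + q := fun v w q => by simp [Φ]
  have hΨ : ∀ v w q, Ψ ((v, w), q) = g v + (a (g w) - a w) + (j : K) • (q : V) :=
    fun v w q => by simp [Ψ]
  obtain ⟨g', hg'⟩ := LinearMap.exists_comp_eq_of_ker_le Φ Ψ (by
    rintro ⟨⟨v, w⟩, q⟩ hk
    rw [LinearMap.mem_ker, hΦ] at hk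
    rw [LinearMap.mem_ker, hΨ]
    have hd : (v : V) + a w ∈ F (j + 1) ⊔ (F (j + 1)).map a :=
      Submodule.add_mem_sup v.2 (Submodule.mem_map_of_mem w.2)
    have hq0 : (q : V) = 0 := by
      have hq : (q : V) = -((v : V) + a w) := by
        rw [eq_neg_iff_add_eq_zero, add_comm]; exact hk
      have hq1 : (q : V) ∈ F (j + 1) ⊔ (F (j + 1)).map a := by
        rw [hq]; exact Submodule.neg_mem _ hd
      exact Submodule.disjoint_def.1 hQ.disjoint _ hq1 q.2.1
    rw [hq0, add_zero] at hk
    have haw : a w = -(v : V) := (neg_eq_of_add_eq_zero_right hk).symm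
    -- Consistency: an overlap v + a w = 0 pushes w one level deeper, exactly where the old operator
    -- already satisfies the commutation rule.
    have hw : (w : V) ∈ F (j + 2) := by
      refine mem_unobservable_succ.2 ⟨(mem_unobservable_succ.1 w.2).1, ?_⟩
      rw [haw]; exact Submodule.neg_mem _ v.2
    rw [hq0, smul_zero, add_zero, ← hga _ hw, ← map_add, hk, map_zero])
  have g1 : ∀ v ∈ F (j + 1), g' v = g v := fun v hv => by
    have := hg' ((⟨v, hv⟩, 0), 0)
    rw [hΦ, hΨ] at this
    simpa using this
  have g2 : ∀ v ∈ F (j + 1), g' (a v) = a (g v) - a v := fun v hv => by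
    have := hg' ((0, ⟨v, hv⟩), 0)
    rw [hΦ, hΨ] at this
    simpa using this
  refine ⟨g', fun i hi u hu => ?_, fun v hv => by rw [g2 v hv, g1 v hv]⟩
  rcases hi.eq_or_lt with rfl | hi
  · have hD : F (j + 1) ⊔ (F (j + 1)).map a ≤ F j :=
      sup_le (anti (Nat.le_succ j)) (Submodule.map_le_iff_le_comap.2 (aF j))
    obtain ⟨d, hd, q, hq, rfl⟩ := Submodule.mem_sup.1
      (show u ∈ (F (j + 1) ⊔ (F (j + 1)).map a) ⊔ Q by rw [hQ.sup_eq_top]; trivial)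
    have hqF : q ∈ F j := by simpa using Submodule.sub_mem _ hu (hD hd)
    obtain ⟨v, hv, w', hw', rfl⟩ := Submodule.mem_sup.1 hd
    obtain ⟨w, hw, rfl⟩ := hw'
    have key := hg' ((⟨v, hv⟩, ⟨w, hw⟩), ⟨q, hq, hqF⟩)
    rw [hΦ, hΨ] at key
    dsimp only at key
    -- On a w the rule turns weight j + 1 of w into weight j, because `a` lowers the filtration
    -- level by one.
    have e : g' (v + a w + q) - (j : K) • (v + a w + q) =
        ((g v - ((j + 1 : ℕ) : K) • v) + v) + a (g w - ((j + 1 : ℕ) : K) • w) := by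
      rw [key]
      simp only [Nat.cast_add, Nat.cast_one, add_smul, one_smul, smul_add, map_sub, map_add,
        map_smul]
      abel
    rw [e]
    exact Submodule.add_mem _
      (Submodule.add_mem _ (anti (Nat.le_succ (j + 1)) (hg _ le_rfl v hv)) hv)
      (aF _ _ (hg _ le_rfl w hw))
  · rw [g1 u (anti hi hu)]
    exact hg i hi u hu

/-- An observable pair has a grading operator along its unobservable filtration. -/
theorem exists_grading (a : V →ₗ[K] V) (c : V →ₗ[K] W) (N : ℕ) (hN : unobservable a c N = ⊥) :
    ∃ g : V →ₗ[K] V,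
      (∀ i, ∀ v ∈ unobservable a c i, g v - (i : K) • v ∈ unobservable a c (i + 1)) ∧
      ∀ v, c v = 0 → g (a v) = a (g v) - a v := by
  have main : ∀ d j, j + d = N → ∃ g : V →ₗ[K] V,
      (∀ i, j ≤ i → ∀ v ∈ unobservable a c i, g v - (i : K) • v ∈ unobservable a c (i + 1)) ∧
      ∀ v ∈ unobservable a c (j + 1), g (a v) = a (g v) - a v := by
    intro d
    induction d with
    | zero =>
      rintro j rfl
      have hz : ∀ i, j ≤ i → ∀ v ∈ unobservable a c i, v = 0 := fun i hi v hv => by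
        have := unobservable_antitone a c hi hv
        rw [show j = j + 0 from rfl, hN] at this
        simpa using this
      refine ⟨0, fun i hi v hv => ?_, fun v hv => ?_⟩
      · simp [hz i hi v hv]
      · simp [hz (j + 1) (by omega) v hv]
    | succ d ih =>
      intro j hj
      obtain ⟨g, h1, h2⟩ := ih (j + 1) (by omega)
      exact exists_grading_step a c j g h1 h2
  obtain ⟨g, h1, h2⟩ := main N 0 (by omega)
  refine ⟨g, fun i => h1 i (Nat.zero_le i), fun v hv => h2 v ?_⟩
  exact mem_unobservable_succ.2 ⟨hv, trivial⟩

end LinearAlgebra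

/-! ### Solvability of the algebraic equation. -/

section Grading

variable {n k : ℕ}

open Polynomial in
-- Spectral mapping: p(μ) lies in the spectrum of p(M) = 0, and any nonzero scalar is in the
-- resolvent set of 0.
theorem aeval_eq_zero_of_mem_spectrum_map {M : Matrix (Fin n) (Fin n) ℝ} {p : ℝ[X]}
    (hp : aeval M p = 0) {μ : ℂ} (hμ : μ ∈ spectrum ℂ (M.map Complex.ofReal)) :
    aeval μ p = 0 := by
  have h1 := spectrum.subset_polynomial_aeval (M.map Complex.ofReal)
    (p.map (algebraMap ℝ ℂ)) ⟨μ, hμ, rfl⟩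
  have h2 : aeval (M.map Complex.ofReal) (p.map (algebraMap ℝ ℂ)) = 0 := by
    rw [Polynomial.aeval_map_algebraMap]
    have h3 : M.map Complex.ofReal = (Algebra.ofId ℝ ℂ).mapMatrix M := rfl
    rw [h3, aeval_algHom_apply, hp, map_zero]
  rw [h2] at h1
  by_contra hne
  refine h1 ?_
  rw [spectrum.mem_resolventSet_iff, sub_zero]
  refine (IsUnit.mk0 _ ?_).map (algebraMap ℂ (Matrix (Fin n) (Fin n) ℂ))
  simpa using hne

theorem eq_zero_of_obsMatrix_rank {A : Matrix (Fin n) (Fin n) ℝ} {C : Matrix (Fin k) (Fin n) ℝ}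
    {N : ℕ} (h : (obsMatrix A C N).rank = n) {x : Fin n → ℝ}
    (hx : ∀ i < N, C *ᵥ (A ^ i *ᵥ x) = 0) : x = 0 := by
  have h1 := LinearMap.finrank_range_add_finrank_ker (obsMatrix A C N).mulVecLin
  rw [← Matrix.rank, h, Module.finrank_fin_fun, Nat.add_eq_left, Submodule.finrank_eq_zero] at h1
  have h2 : x ∈ LinearMap.ker (obsMatrix A C N).mulVecLin := by
    rw [LinearMap.mem_ker, Matrix.mulVecLin_apply]
    ext p
    have := congrFun (hx p.1 p.1.2) p.2
    rwa [Matrix.mulVec_mulVec] at this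
  rw [h1] at h2
  simpa using h2

open Polynomial in
-- The factor X - (1 + νi), evaluated at `genD G₀ ν`, maps F i into F (i+1). The product over i < N
-- thus maps everything into F N = 0 and annihilates the matrix.
theorem eq_of_mem_spectrum_genD {G₀ : Matrix (Fin n) (Fin n) ℝ}
    {F : ℕ → Submodule ℝ (Fin n → ℝ)} {N : ℕ} (h0 : F 0 = ⊤) (hN : F N = ⊥)
    (hF : ∀ i, ∀ v ∈ F i, G₀ *ᵥ v - (i : ℝ) • v ∈ F (i + 1)) {ν : ℝ} {μ : ℂ}
    (hμ : μ ∈ spectrum ℂ ((genD G₀ ν).map Complex.ofReal)) : ∃ i < N, μ = 1 + ν * i := by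
  let p : ℕ → ℝ[X] := fun j => ∏ i ∈ Finset.range j, (X - C (1 + ν * i))
  have hp : ∀ j v, aeval (genD G₀ ν) (p j) *ᵥ v ∈ F j := by
    intro j v
    induction j with
    | zero => simp [h0]
    | succ j ih =>
      have e : p (j + 1) = (X - C (1 + ν * (j : ℝ))) * p j := by
        simp only [p, Finset.prod_range_succ]; ring
      have e2 : aeval (genD G₀ ν) (p (j + 1)) *ᵥ v =
          ν • (G₀ *ᵥ (aeval (genD G₀ ν) (p j) *ᵥ v) -
            (j : ℝ) • (aeval (genD G₀ ν) (p j) *ᵥ v)) := by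
        rw [e, map_mul, ← Matrix.mulVec_mulVec, map_sub, aeval_X, aeval_C,
          Algebra.algebraMap_eq_smul_one, Matrix.sub_mulVec, Matrix.smul_mulVec,
          Matrix.one_mulVec]
        generalize aeval (genD G₀ ν) (p j) *ᵥ v = w
        rw [genD, Matrix.add_mulVec, Matrix.one_mulVec, Matrix.smul_mulVec]
        module
      rw [e2]
      exact Submodule.smul_mem _ _ (hF j _ ih)
  have hz : aeval (genD G₀ ν) (p N) = 0 := by
    refine Matrix.ext_of_mulVec_single fun i => ?_
    have := hp N (Pi.single i 1)
    rw [hN, Submodule.mem_bot] at this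
    rw [this, Matrix.zero_mulVec]
  have h1 := aeval_eq_zero_of_mem_spectrum_map hz hμ
  simp only [p, map_prod, Finset.prod_eq_zero_iff, Finset.mem_range, map_sub, aeval_X, aeval_C,
    sub_eq_zero] at h1
  obtain ⟨i, hi, h⟩ := h1
  exact ⟨i, hi, by simpa using h⟩

theorem one_add_mul_pos {N : ℕ} {ν : ℝ} (hν : -1 / (N : ℝ) ≤ ν) {i : ℕ} (hi : i < N) :
    1 / (N : ℝ) ≤ 1 + ν * i := by
  have hN : (0 : ℝ) < N := by exact_mod_cast (Nat.zero_le i).trans_lt hi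
  have hi' : (i : ℝ) + 1 ≤ N := by exact_mod_cast hi
  have h1 : -1 / (N : ℝ) * i ≤ ν * i := mul_le_mul_of_nonneg_right hν (Nat.cast_nonneg i)
  have h2 : 1 / (N : ℝ) * (i + 1) ≤ 1 / (N : ℝ) * N := by gcongr
  rw [one_div_mul_cancel hN.ne'] at h2
  have h3 : -1 / (N : ℝ) * i = -(1 / (N : ℝ) * i) := by ring
  linarith

theorem isUnit_of_antiHurwitz {G : Matrix (Fin n) (Fin n) ℝ} (h : AntiHurwitz G) : IsUnit G := by
  have h0 : (0 : ℂ) ∉ spectrum ℂ (G.map Complex.ofReal) := fun h' => by simpa using h 0 h'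
  rw [spectrum.zero_notMem_iff, Matrix.isUnit_iff_isUnit_det] at h0
  have h1 : (G.map Complex.ofReal).det = (G.det : ℂ) := by
    exact (RingHom.map_det Complex.ofRealHom G).symm
  rw [h1] at h0
  rw [Matrix.isUnit_iff_isUnit_det]
  simpa using h0

theorem one_add_mul_matA₀ {A : Matrix (Fin n) (Fin n) ℝ} {C : Matrix (Fin k) (Fin n) ℝ}
    {G₀ : Matrix (Fin n) (Fin n) ℝ} {Y₀ : Matrix (Fin n) (Fin k) ℝ}
    (heq : A * G₀ - G₀ * A + Y₀ * C = A) (hinv : IsUnit (1 + G₀)) :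
    (1 + G₀) * matA₀ A C G₀ Y₀ = A * G₀ := by
  rw [matA₀, mul_sub, Matrix.mul_assoc _ Y₀ C,
    Matrix.mul_nonsing_inv_cancel_left _ _ ((Matrix.isUnit_iff_isUnit_det _).1 hinv)]
  rw [add_mul, one_mul]
  nth_rewrite 1 [← heq]
  abel

/-- Both sides equal AG₀: the left because CG₀ = 0, the right by the algebraic equation. -/
theorem matA₀_mul_of_eqn {A : Matrix (Fin n) (Fin n) ℝ} {C : Matrix (Fin k) (Fin n) ℝ}
    {G₀ : Matrix (Fin n) (Fin n) ℝ} {Y₀ : Matrix (Fin n) (Fin k) ℝ}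
    (heq : A * G₀ - G₀ * A + Y₀ * C = A) (hC : C * G₀ = 0) (hinv : IsUnit (1 + G₀)) :
    matA₀ A C G₀ Y₀ * G₀ = (1 + G₀) * matA₀ A C G₀ Y₀ := by
  rw [one_add_mul_matA₀ heq hinv, matA₀, sub_mul, Matrix.mul_assoc _ C G₀, hC, Matrix.mul_zero,
    sub_zero]

theorem exists_isHomogenizing {A : Matrix (Fin n) (Fin n) ℝ} {C : Matrix (Fin k) (Fin n) ℝ}
    {N : ℕ} (hN : IsObsIndex A C N) :
    ∃ (G₀ : Matrix (Fin n) (Fin n) ℝ) (Y₀ : Matrix (Fin n) (Fin k) ℝ),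
      IsHomogenizing A C N G₀ Y₀ := by
  set F := unobservable (toLin' A) (toLin' C) with hFdef
  have hFN : F N = ⊥ := by
    rw [Submodule.eq_bot_iff]
    intro x hx
    refine eq_zero_of_obsMatrix_rank hN.1.2 fun i hi => ?_
    have := mem_unobservable_iff.1 hx i hi
    rwa [← Matrix.toLin'_pow, toLin'_apply, toLin'_apply] at this
  obtain ⟨g, hg, hga⟩ := exists_grading (toLin' A) (toLin' C) N hFN
  set G₀ := LinearMap.toMatrix' g with hG₀
  have hgG : g = toLin' G₀ := (Matrix.toLin'_toMatrix' g).symm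
  have hF : ∀ i, ∀ v ∈ F i, G₀ *ᵥ v - (i : ℝ) • v ∈ F (i + 1) := fun i v hv => by
    have := hg i v hv
    rwa [hgG, toLin'_apply] at this
  have hC : C * G₀ = 0 := by
    refine Matrix.ext_of_mulVec_single fun i => ?_
    -- At level 0 the grading condition says that the image of `G₀` lies in F 1 = ker C.
    have := (mem_unobservable_succ.1 (hF 0 (Pi.single i 1) trivial)).1
    rw [← Matrix.mulVec_mulVec, Matrix.zero_mulVec]
    simpa only [Nat.cast_zero, zero_smul, sub_zero, toLin'_apply] using this
  obtain ⟨q, hq⟩ := LinearMap.exists_comp_eq_of_ker_le (toLin' C) (toLin' (A + G₀ * A - A * G₀)) (by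
    intro v hv
    have h1 := hga v hv
    simp only [hgG, toLin'_apply, Matrix.mulVec_mulVec] at h1
    rw [LinearMap.mem_ker, toLin'_apply, Matrix.sub_mulVec, Matrix.add_mulVec, h1]
    abel)
  have heq : A * G₀ - G₀ * A + LinearMap.toMatrix' q * C = A := by
    have : LinearMap.toMatrix' q * C = A + G₀ * A - A * G₀ := by
      refine Matrix.ext_of_mulVec_single fun i => ?_
      have := hq (Pi.single i 1)
      rw [toLin'_apply, toLin'_apply] at this
      rw [← this, ← Matrix.mulVec_mulVec, LinearMap.toMatrix'_mulVec]
    rw [this]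
    abel
  have hpos : ∀ ν : ℝ, -1 / (N : ℝ) ≤ ν → AntiHurwitz (genD G₀ ν) := fun ν hν μ hμ => by
    obtain ⟨i, hi, rfl⟩ := eq_of_mem_spectrum_genD rfl hFN hF hμ
    have hi0 : (0 : ℝ) < N := by exact_mod_cast (Nat.zero_le i).trans_lt hi
    have := one_add_mul_pos hν hi
    have h2 : (1 + (ν : ℂ) * (i : ℂ)).re = 1 + ν * i := by simp
    rw [h2]
    exact (one_div_pos.2 hi0).trans_le this
  have hinv : IsUnit (1 + G₀) := by
    -- I + G₀ is the generator for ν = 1, which is admissible.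
    have := isUnit_of_antiHurwitz (hpos 1 (by
      rw [neg_div]
      exact (neg_nonpos.2 (by positivity)).trans zero_le_one))
    simpa [genD] using this
  refine ⟨G₀, LinearMap.toMatrix' q, heq, hC, hpos, hinv, fun ν => ?_, fun ν => ?_⟩
  · have h := matA₀_mul_of_eqn heq hC hinv
    rw [genD, mul_add, mul_one, Matrix.mul_smul, h]
    simp only [add_mul, one_mul, smul_mul_assoc, smul_add]
    abel
  · rw [genD, Matrix.mul_add, Matrix.mul_one, Matrix.mul_smul, hC, smul_zero, add_zero]

end Grading

/-! ### Estimates for block tridiagonal forms. -/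

section Ladder

variable {n k : ℕ}

theorem two_mul_mul_dotProduct_le (a b : ℝ) (u v : Fin k → ℝ) :
    2 * (a * b * (u ⬝ᵥ v)) ≤ a ^ 2 * (u ⬝ᵥ u) + b ^ 2 * (v ⬝ᵥ v) := by
  have h : 0 ≤ (a • u - b • v) ⬝ᵥ (a • u - b • v) := by
    simpa using dotProduct_star_self_nonneg (a • u - b • v)
  simp only [sub_dotProduct, dotProduct_sub, smul_dotProduct, dotProduct_smul, smul_eq_mul,
    dotProduct_comm v u] at h
  nlinarith

theorem abs_two_mul_mul_dotProduct_le (a b : ℝ) (u v : Fin k → ℝ) :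
    |2 * (a * b * (u ⬝ᵥ v))| ≤ a ^ 2 * (u ⬝ᵥ u) + b ^ 2 * (v ⬝ᵥ v) := by
  refine abs_le'.2 ⟨two_mul_mul_dotProduct_le a b u v, ?_⟩
  have := two_mul_mul_dotProduct_le a (-b) u v
  rw [neg_sq] at this
  linarith

theorem dotProduct_self_nonneg_real (u : Fin k → ℝ) : 0 ≤ u ⬝ᵥ u := by
  simpa using dotProduct_star_self_nonneg u

theorem sum_range_shift {f : ℕ → ℝ} {N : ℕ} (h : f N = 0) :
    ∑ j ∈ Finset.range N, f (j + 1) = ∑ j ∈ Finset.range N, f j - f 0 := by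
  have h1 := Finset.sum_range_succ f N
  rw [Finset.sum_range_succ' f N, h] at h1
  linarith

/-- The block tridiagonal form `∑ j, l^(2j)² Mⱼᵀ Mⱼ - l^(2j+1)² (Mⱼᵀ Mⱼ₊₁ + Mⱼ₊₁ᵀ Mⱼ)`. -/
def ladderMatrix (M : ℕ → Matrix (Fin k) (Fin n) ℝ) (l : ℝ) (N : ℕ) :
    Matrix (Fin n) (Fin n) ℝ :=
  ∑ j ∈ Finset.range N, (l ^ (4 * j ^ 2) • ((M j)ᵀ * M j) -
    l ^ ((2 * j + 1) ^ 2) • ((M j)ᵀ * M (j + 1) + (M (j + 1))ᵀ * M j))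

theorem ladderMatrix_transpose (M : ℕ → Matrix (Fin k) (Fin n) ℝ) (l : ℝ) (N : ℕ) :
    (ladderMatrix M l N)ᵀ = ladderMatrix M l N := by
  simp only [ladderMatrix, Matrix.transpose_sum, Matrix.transpose_sub, Matrix.transpose_smul,
    Matrix.transpose_add, Matrix.transpose_mul, Matrix.transpose_transpose]
  refine Finset.sum_congr rfl fun j _ => ?_
  rw [add_comm ((M (j + 1))ᵀ * M j)]

theorem dotProduct_transpose_mul_mulVec (M M' : Matrix (Fin k) (Fin n) ℝ) (x y : Fin n → ℝ) :
    x ⬝ᵥ ((Mᵀ * M') *ᵥ y) = (M *ᵥ x) ⬝ᵥ (M' *ᵥ y) := by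
  rw [← Matrix.mulVec_mulVec, Matrix.dotProduct_mulVec, Matrix.vecMul_transpose]

theorem dotProduct_ladderMatrix (M : ℕ → Matrix (Fin k) (Fin n) ℝ) (l : ℝ) (N : ℕ)
    (x y : Fin n → ℝ) :
    x ⬝ᵥ (ladderMatrix M l N *ᵥ y) = ∑ j ∈ Finset.range N,
      (l ^ (4 * j ^ 2) * ((M j *ᵥ x) ⬝ᵥ (M j *ᵥ y)) - l ^ ((2 * j + 1) ^ 2) *
        ((M j *ᵥ x) ⬝ᵥ (M (j + 1) *ᵥ y) + (M (j + 1) *ᵥ x) ⬝ᵥ (M j *ᵥ y))) := by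
  simp only [ladderMatrix, Matrix.sum_mulVec, dotProduct_sum, Matrix.sub_mulVec, dotProduct_sub,
    Matrix.smul_mulVec, dotProduct_smul, Matrix.add_mulVec, dotProduct_add,
    dotProduct_transpose_mul_mulVec, smul_eq_mul]

variable {u : ℕ → Fin k → ℝ} {l : ℝ} {N : ℕ}

/-- The mean of the exponents 4j² and 4(j+1)² is (2j+1)² + 1, so Young's inequality leaves a spare
factor `l` on the cross term. -/
theorem ladder_cross_le (hl : 1 ≤ l) (j : ℕ) :
    2 * (l * |l ^ ((2 * j + 1) ^ 2) * (u j ⬝ᵥ u (j + 1))|) ≤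
      l ^ (4 * j ^ 2) * (u j ⬝ᵥ u j) + l ^ (4 * (j + 1) ^ 2) * (u (j + 1) ⬝ᵥ u (j + 1)) := by
  have h := abs_two_mul_mul_dotProduct_le (l ^ (2 * j ^ 2)) (l ^ (2 * (j + 1) ^ 2)) (u j) (u (j + 1))
  rw [← pow_add, ← pow_mul, ← pow_mul,
    show 2 * j ^ 2 + 2 * (j + 1) ^ 2 = 1 + (2 * j + 1) ^ 2 by ring, pow_add, pow_one, mul_assoc,
    abs_mul, abs_mul, abs_two, abs_of_pos (zero_lt_one.trans_le hl),
    show 2 * j ^ 2 * 2 = 4 * j ^ 2 by ring,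
    show 2 * (j + 1) ^ 2 * 2 = 4 * (j + 1) ^ 2 by ring] at h
  exact h

/-- The off-diagonal part of a ladder form with coefficients bounded by `c`. -/
theorem abs_sum_ladder_cross_le (hl : 1 ≤ l) (huN : u N = 0) {c : ℕ → ℝ} {K : ℝ} (hK : 0 ≤ K)
    (hc : ∀ j < N, |c j| ≤ K) :
    l * |∑ j ∈ Finset.range N, l ^ ((2 * j + 1) ^ 2) * (c j * (u j ⬝ᵥ u (j + 1)))| ≤
      K * ∑ j ∈ Finset.range N, l ^ (4 * j ^ 2) * (u j ⬝ᵥ u j) := by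
  set p : ℕ → ℝ := fun j => l ^ (4 * j ^ 2) * (u j ⬝ᵥ u j) with hp
  have hp0 : ∀ j, 0 ≤ p j := fun j =>
    mul_nonneg (pow_nonneg (zero_le_one.trans hl) _) (dotProduct_self_nonneg_real _)
  have h1 : ∀ j ∈ Finset.range N,
      l * |l ^ ((2 * j + 1) ^ 2) * (c j * (u j ⬝ᵥ u (j + 1)))| ≤ K * ((p j + p (j + 1)) / 2) := by
    intro j hj
    have hcr := ladder_cross_le (u := u) hl j
    have e : l * |l ^ ((2 * j + 1) ^ 2) * (c j * (u j ⬝ᵥ u (j + 1)))| =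
        |c j| * (l * |l ^ ((2 * j + 1) ^ 2) * (u j ⬝ᵥ u (j + 1))|) := by
      simp only [abs_mul]; ring
    rw [e]
    refine mul_le_mul (hc j (Finset.mem_range.1 hj)) ?_ (by positivity) hK
    simp only [hp]
    linarith
  have hs : ∑ j ∈ Finset.range N, p (j + 1) = ∑ j ∈ Finset.range N, p j - p 0 :=
    sum_range_shift (by simp [hp, huN])
  calc l * |∑ j ∈ Finset.range N, l ^ ((2 * j + 1) ^ 2) * (c j * (u j ⬝ᵥ u (j + 1)))|
      ≤ l * ∑ j ∈ Finset.range N, |l ^ ((2 * j + 1) ^ 2) * (c j * (u j ⬝ᵥ u (j + 1)))| :=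
        mul_le_mul_of_nonneg_left (Finset.abs_sum_le_sum_abs _ _) (zero_le_one.trans hl)
    _ = ∑ j ∈ Finset.range N, l * |l ^ ((2 * j + 1) ^ 2) * (c j * (u j ⬝ᵥ u (j + 1)))| :=
        Finset.mul_sum _ _ _
    _ ≤ ∑ j ∈ Finset.range N, K * ((p j + p (j + 1)) / 2) := Finset.sum_le_sum h1
    _ = K * ((∑ j ∈ Finset.range N, p j + ∑ j ∈ Finset.range N, p (j + 1)) / 2) := by
        rw [← Finset.mul_sum, ← Finset.sum_div, Finset.sum_add_distrib]
    _ ≤ K * ∑ j ∈ Finset.range N, p j := by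
        refine mul_le_mul_of_nonneg_left ?_ hK
        rw [hs]
        linarith [hp0 0]

/-- The left side is the derivative of the ladder form along the shift u_j ↦ u_{j+1}. Its good terms
are -2l·r_{j+1}. Young's inequality bounds the products of u_j with u_{j+1} exactly, and those with
u_{j+2} with l³ to spare, by sums of r's. Hence l ≥ 4 makes everything negative except r_0, which no
good term covers. -/
theorem ladder_derivative_le (hl : 4 ≤ l) (hN : 1 ≤ N) (huN : ∀ j, N ≤ j → u j = 0) :
    2 * ∑ j ∈ Finset.range N, (l ^ (4 * j ^ 2) * (u j ⬝ᵥ u (j + 1)) -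
      l ^ ((2 * j + 1) ^ 2) * (u j ⬝ᵥ u (j + 2) + u (j + 1) ⬝ᵥ u (j + 1))) ≤
    8 * (u 0 ⬝ᵥ u 0) - 4 * ∑ j ∈ Finset.range N, l ^ (4 * (j * (j - 1))) * (u j ⬝ᵥ u j) := by
  have hl0 : 0 ≤ l := by linarith
  -- Truncated subtraction is harmless at j = 0, where the factor j makes the exponent zero.
  set r : ℕ → ℝ := fun j => l ^ (4 * (j * (j - 1))) * (u j ⬝ᵥ u j) with hr
  have hr0 : ∀ j, 0 ≤ r j := fun j =>
    mul_nonneg (pow_nonneg hl0 _) (dotProduct_self_nonneg_real _)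
  have hrN : ∀ j, N ≤ j → r j = 0 := fun j hj => by simp [hr, huN j hj]
  have h1 : ∀ j, 2 * (l ^ (4 * j ^ 2) * (u j ⬝ᵥ u (j + 1))) ≤ r j + r (j + 1) := by
    intro j
    have h := two_mul_mul_dotProduct_le (l ^ (2 * (j * (j - 1)))) (l ^ (2 * ((j + 1) * j)))
      (u j) (u (j + 1))
    have e : 2 * (j * (j - 1)) + 2 * ((j + 1) * j) = 4 * j ^ 2 := by
      cases j with
      | zero => rfl
      | succ i => simp only [Nat.add_sub_cancel]; ring
    rw [← pow_add, e, ← pow_mul, ← pow_mul] at h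
    simp only [hr, Nat.add_sub_cancel]
    convert h using 4 <;> ring
  have h2 : ∀ j, -(2 * (l ^ ((2 * j + 1) ^ 2) * (u j ⬝ᵥ u (j + 2)))) ≤ r j + r (j + 2) := by
    intro j
    have h := abs_two_mul_mul_dotProduct_le (l ^ (2 * (j * (j - 1))))
      (l ^ (2 * ((j + 2) * (j + 1)))) (u j) (u (j + 2))
    have e : 2 * (j * (j - 1)) + 2 * ((j + 2) * (j + 1)) = (2 * j + 1) ^ 2 + 3 := by
      cases j with
      | zero => rfl
      | succ i => simp only [Nat.add_sub_cancel]; ring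
    have e2 : l ^ (2 * (j * (j - 1))) * l ^ (2 * ((j + 2) * (j + 1))) =
        l ^ ((2 * j + 1) ^ 2) * l ^ 3 := by rw [← pow_add, e, pow_add]
    have h3 : |2 * (l ^ ((2 * j + 1) ^ 2) * (u j ⬝ᵥ u (j + 2)))| ≤
        |2 * (l ^ (2 * (j * (j - 1))) * l ^ (2 * ((j + 2) * (j + 1))) * (u j ⬝ᵥ u (j + 2)))| := by
      rw [e2, show 2 * (l ^ ((2 * j + 1) ^ 2) * l ^ 3 * (u j ⬝ᵥ u (j + 2))) =
        l ^ 3 * (2 * (l ^ ((2 * j + 1) ^ 2) * (u j ⬝ᵥ u (j + 2)))) by ring, abs_mul (l ^ 3)]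
      refine le_mul_of_one_le_left (abs_nonneg _) ?_
      rw [abs_of_nonneg (by positivity)]
      exact one_le_pow₀ (by linarith)
    refine (neg_le_abs _).trans (h3.trans (h.trans (le_of_eq ?_)))
    rw [← pow_mul, ← pow_mul]
    simp only [hr, show j + 2 - 1 = j + 1 from rfl]
    congr 3 <;> ring
  have h3 : ∀ j, l ^ ((2 * j + 1) ^ 2) * (u (j + 1) ⬝ᵥ u (j + 1)) = l * r (j + 1) := by
    intro j
    simp only [hr, Nat.add_sub_cancel]
    rw [← mul_assoc, ← pow_succ']
    congr 2
    ring
  have s1 : ∑ j ∈ Finset.range N, r (j + 1) = ∑ j ∈ Finset.range N, r j - r 0 :=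
    sum_range_shift (hrN N le_rfl)
  have s2 : ∑ j ∈ Finset.range N, r (j + 2) = ∑ j ∈ Finset.range N, r (j + 1) - r 1 :=
    sum_range_shift (f := fun j => r (j + 1)) (hrN (N + 1) (by omega))
  have hS : r 0 ≤ ∑ j ∈ Finset.range N, r j :=
    Finset.single_le_sum (fun j _ => hr0 j) (Finset.mem_range.2 hN)
  have hr00 : r 0 = u 0 ⬝ᵥ u 0 := by simp [hr]
  calc _ = ∑ j ∈ Finset.range N, (2 * (l ^ (4 * j ^ 2) * (u j ⬝ᵥ u (j + 1))) +
        -(2 * (l ^ ((2 * j + 1) ^ 2) * (u j ⬝ᵥ u (j + 2)))) - 2 * (l * r (j + 1))) := by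
        rw [Finset.mul_sum]
        refine Finset.sum_congr rfl fun j _ => ?_
        rw [← h3]
        ring
    _ ≤ ∑ j ∈ Finset.range N, (2 * r j + r (j + 1) + r (j + 2) - 2 * l * r (j + 1)) :=
        Finset.sum_le_sum fun j _ => by linarith [h1 j, h2 j]
    _ = 2 * ∑ j ∈ Finset.range N, r j + ∑ j ∈ Finset.range N, r (j + 1) +
        ∑ j ∈ Finset.range N, r (j + 2) - 2 * l * ∑ j ∈ Finset.range N, r (j + 1) := by
        simp only [Finset.sum_sub_distrib, Finset.sum_add_distrib, Finset.mul_sum]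
    _ ≤ _ := by
        rw [s2, s1, ← hr00]
        have := mul_le_mul_of_nonneg_right hl (sub_nonneg.2 hS)
        linarith [hr0 0, hr0 1]

end Ladder

/-! ### Feasibility of the linear matrix inequality. -/

section LMI

variable {n k : ℕ}

theorem posDef_of_transpose_eq {P : Matrix (Fin n) (Fin n) ℝ} (hP : Pᵀ = P)
    (h : ∀ x : Fin n → ℝ, x ≠ 0 → 0 < x ⬝ᵥ (P *ᵥ x)) : P.PosDef :=
  .of_dotProduct_mulVec_pos (by rwa [Matrix.IsHermitian, conjTranspose_eq_transpose_of_trivial])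
    fun x hx => by simpa using h x hx

theorem posSemidef_of_transpose_eq {P : Matrix (Fin n) (Fin n) ℝ} (hP : Pᵀ = P)
    (h : ∀ x : Fin n → ℝ, 0 ≤ x ⬝ᵥ (P *ᵥ x)) : P.PosSemidef :=
  .of_dotProduct_mulVec_nonneg (by rwa [Matrix.IsHermitian, conjTranspose_eq_transpose_of_trivial])
    fun x => by simpa using h x

theorem transpose_lyapunov {P : Matrix (Fin n) (Fin n) ℝ} (hP : Pᵀ = P)
    (G : Matrix (Fin n) (Fin n) ℝ) : (P * G + Gᵀ * P)ᵀ = P * G + Gᵀ * P := by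
  rw [transpose_add, transpose_mul, transpose_mul, transpose_transpose, hP, add_comm]

theorem dotProduct_lyapunov {P : Matrix (Fin n) (Fin n) ℝ} (hP : Pᵀ = P)
    (G : Matrix (Fin n) (Fin n) ℝ) (x : Fin n → ℝ) :
    x ⬝ᵥ ((P * G + Gᵀ * P) *ᵥ x) = 2 * (x ⬝ᵥ (P *ᵥ (G *ᵥ x))) := by
  rw [add_mulVec, dotProduct_add, ← mulVec_mulVec, ← mulVec_mulVec, dotProduct_mulVec x Gᵀ,
    vecMul_transpose, dotProduct_mulVec (G *ᵥ x), ← mulVec_transpose, hP,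
    dotProduct_comm (P *ᵥ _), two_mul]

variable {A : Matrix (Fin n) (Fin n) ℝ} {C : Matrix (Fin k) (Fin n) ℝ} {N : ℕ}
  {G₀ : Matrix (Fin n) (Fin n) ℝ} {Y₀ : Matrix (Fin n) (Fin k) ℝ}

theorem IsHomogenizing.matA₀_mul (h : IsHomogenizing A C N G₀ Y₀) :
    matA₀ A C G₀ Y₀ * G₀ = (1 + G₀) * matA₀ A C G₀ Y₀ :=
  matA₀_mul_of_eqn h.eqn h.eqnC h.invertible

/-- The rows of C have weight 0 under right multiplication by `G₀`, and each factor A₀ raises the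
weight by one. -/
theorem IsHomogenizing.output_mul_pow_mul (h : IsHomogenizing A C N G₀ Y₀) (j : ℕ) :
    C * matA₀ A C G₀ Y₀ ^ j * G₀ = (j : ℝ) • (C * matA₀ A C G₀ Y₀ ^ j) := by
  induction j with
  | zero => simp [h.eqnC]
  | succ j ih =>
    rw [pow_succ, Matrix.mul_assoc, Matrix.mul_assoc (_ ^ j), h.matA₀_mul, add_mul, one_mul,
      Matrix.mul_add, Matrix.mul_add, ← Matrix.mul_assoc (_ ^ j), ← Matrix.mul_assoc C,
      ← Matrix.mul_assoc C, ← Matrix.mul_assoc C, ih, Nat.cast_succ, add_smul, one_smul,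
      Matrix.smul_mul, add_comm, Matrix.mul_assoc]

theorem IsHomogenizing.output_mul_pow_mul_genD (h : IsHomogenizing A C N G₀ Y₀) (ν : ℝ) (j : ℕ) :
    C * matA₀ A C G₀ Y₀ ^ j * genD G₀ ν = (1 + ν * j) • (C * matA₀ A C G₀ Y₀ ^ j) := by
  rw [genD, Matrix.mul_add, Matrix.mul_one, Matrix.mul_smul, h.output_mul_pow_mul, smul_smul,
    add_smul, one_smul]

/-- Here the endpoint ν = -1/N of the anti-Hurwitz property is decisive: CA₀ᴺ has eigenvalue 1 - N/N
= 0 under an invertible matrix. -/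
theorem IsHomogenizing.output_mul_pow_eq_zero (h : IsHomogenizing A C N G₀ Y₀) (hN : 1 ≤ N)
    {j : ℕ} (hj : N ≤ j) : C * matA₀ A C G₀ Y₀ ^ j = 0 := by
  have h1 : C * matA₀ A C G₀ Y₀ ^ N = 0 := by
    have h2 := h.output_mul_pow_mul_genD (-1 / (N : ℝ)) N
    have hN0 : (N : ℝ) ≠ 0 := by positivity
    rw [div_mul_cancel₀ _ hN0, add_neg_cancel, zero_smul] at h2
    have hu := (isUnit_iff_isUnit_det _).1 (isUnit_of_antiHurwitz (h.antiHurwitz _ le_rfl))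
    rw [← mul_nonsing_inv_cancel_right _ (C * matA₀ A C G₀ Y₀ ^ N) hu, h2, Matrix.zero_mul]
  obtain ⟨d, rfl⟩ := Nat.exists_eq_add_of_le hj
  rw [pow_add, ← Matrix.mul_assoc, h1, Matrix.zero_mul]

theorem matA₀_mulVec_eq_of_output_eq_zero {x : Fin n → ℝ} (hx : C *ᵥ x = 0) :
    matA₀ A C G₀ Y₀ *ᵥ x = A *ᵥ x := by
  rw [matA₀, sub_mulVec, ← mulVec_mulVec, hx, mulVec_zero, sub_zero]

/-- Output injection preserves observability: as long as the outputs vanish, A₀ and A have the same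
trajectory. -/
theorem eq_zero_of_output_matA₀ (hrank : (obsMatrix A C N).rank = n) {x : Fin n → ℝ}
    (hx : ∀ i < N, (C * matA₀ A C G₀ Y₀ ^ i) *ᵥ x = 0) : x = 0 := by
  have h1 : ∀ i ≤ N, matA₀ A C G₀ Y₀ ^ i *ᵥ x = A ^ i *ᵥ x := by
    intro i hi
    induction i with
    | zero => simp
    | succ i ih =>
      have h0 := hx i hi
      rw [← mulVec_mulVec] at h0
      rw [pow_succ', ← mulVec_mulVec, matA₀_mulVec_eq_of_output_eq_zero h0, ih (by omega),
        mulVec_mulVec, ← pow_succ']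
  refine eq_zero_of_obsMatrix_rank hrank fun i hi => ?_
  rw [← h1 i hi.le, mulVec_mulVec]
  exact hx i hi

theorem IsHomogenizing.exists_solvesLMI (h : IsHomogenizing A C N G₀ Y₀) (hN : 1 ≤ N)
    (hrank : (obsMatrix A C N).rank = n) {ν : ℝ} (hν : -1 / (N : ℝ) ≤ ν) {ρ : ℝ} (hρ : 0 < ρ) :
    ∃ (P : Matrix (Fin n) (Fin n) ℝ) (Y : Matrix (Fin n) (Fin k) ℝ),
      SolvesLMI (matA₀ A C G₀ Y₀) C (genD G₀ ν) ρ P Y := by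
  have hN1 : (1 : ℝ) ≤ N := by exact_mod_cast hN
  have hN0 : (0 : ℝ) < N := by linarith
  set A₀ := matA₀ A C G₀ Y₀ with hA₀
  set G := genD G₀ ν with hG
  -- `K` bounds every weight |1 + νj| with j ≤ N. The choice l = 4KN then makes the cross terms of
  -- PG at most half of its diagonal part. The size of θ lets the decay due to A₀ outweigh the term
  -- with ρ.
  set K : ℝ := 1 + |ν| * N with hKdef
  have hK1 : 1 ≤ K := by
    have : 0 ≤ |ν| * N := by positivity
    linarith
  set l : ℝ := 4 * K * N with hldef
  have hl : 4 ≤ l := by nlinarith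
  have hl1 : 1 ≤ l := by linarith
  have hl0 : 0 < l := by linarith
  set θ : ℝ := 1 + ρ * 3 * K * l ^ (4 * N) with hθdef
  have hθ0 : 0 < θ := by positivity
  -- In the rescaled coordinates A₀ becomes θ times the shift, while the diagonal action of `G` is
  -- unaffected by θ.
  let M : ℕ → Matrix (Fin k) (Fin n) ℝ := fun j => θ⁻¹ ^ j • (C * A₀ ^ j)
  have hMG : ∀ j (x : Fin n → ℝ), M j *ᵥ (G *ᵥ x) = (1 + ν * j) • (M j *ᵥ x) := fun j x => by
    rw [mulVec_mulVec]
    simp only [M]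
    rw [Matrix.smul_mul, h.output_mul_pow_mul_genD, smul_comm, smul_mulVec]
  have hMA : ∀ j (x : Fin n → ℝ), M j *ᵥ (A₀ *ᵥ x) = θ • (M (j + 1) *ᵥ x) := fun j x => by
    rw [mulVec_mulVec, ← smul_mulVec]
    simp only [M]
    rw [Matrix.smul_mul, Matrix.mul_assoc, ← pow_succ, smul_smul, pow_succ' θ⁻¹,
      mul_inv_cancel_left₀ hθ0.ne']
  have hMN : ∀ j, N ≤ j → M j = 0 := fun j hj => by
    simp only [M]
    rw [h.output_mul_pow_eq_zero hN hj, smul_zero]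
  have hM0 : M 0 = C := by simp [M]
  have hg : ∀ j ≤ N, |1 + ν * (j : ℝ)| ≤ K := fun j hj => by
    refine (abs_add_le _ _).trans ?_
    rw [abs_one, abs_mul, Nat.abs_cast, hKdef]
    gcongr
  set P := ladderMatrix M l N with hPdef
  have hPT : Pᵀ = P := ladderMatrix_transpose M l N
  let T : (Fin n → ℝ) → ℝ := fun x =>
    ∑ j ∈ Finset.range N, l ^ (4 * j ^ 2) * ((M j *ᵥ x) ⬝ᵥ (M j *ᵥ x))
  have hT0 : ∀ x, x ≠ 0 → 0 < T x := by
    intro x hx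
    have hnn : ∀ j ∈ Finset.range N, 0 ≤ l ^ (4 * j ^ 2) * ((M j *ᵥ x) ⬝ᵥ (M j *ᵥ x)) :=
      fun j _ => mul_nonneg (by positivity) (dotProduct_self_nonneg_real _)
    refine (Finset.sum_nonneg hnn).lt_of_ne fun h0 => hx ?_
    refine eq_zero_of_output_matA₀ (G₀ := G₀) (Y₀ := Y₀) hrank fun i hi => ?_
    have h1 := (Finset.sum_eq_zero_iff_of_nonneg hnn).1 h0.symm i (Finset.mem_range.2 hi)
    have h2 := (mul_eq_zero.1 h1).resolve_left (by positivity)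
    have h3 : M i *ᵥ x = 0 := dotProduct_self_eq_zero.1 h2
    simp only [M, smul_mulVec] at h3
    exact (smul_eq_zero.1 h3).resolve_left (by positivity)
  have hcross : ∀ x {c : ℕ → ℝ} {κ : ℝ}, 0 ≤ κ → (∀ j < N, |c j| ≤ κ) →
      l * |∑ j ∈ Finset.range N, l ^ ((2 * j + 1) ^ 2) *
        (c j * ((M j *ᵥ x) ⬝ᵥ (M (j + 1) *ᵥ x)))| ≤ κ * T x := fun x c κ hκ hc =>
    abs_sum_ladder_cross_le (u := fun j => M j *ᵥ x) hl1 (by simp [hMN]) hκ hc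
  have hPpos : ∀ x, x ≠ 0 → 0 < x ⬝ᵥ (P *ᵥ x) := by
    intro x hx
    have e : x ⬝ᵥ (P *ᵥ x) = T x - ∑ j ∈ Finset.range N, l ^ ((2 * j + 1) ^ 2) *
        (2 * ((M j *ᵥ x) ⬝ᵥ (M (j + 1) *ᵥ x))) := by
      rw [hPdef, dotProduct_ladderMatrix, ← Finset.sum_sub_distrib]
      refine Finset.sum_congr rfl fun j _ => ?_
      rw [dotProduct_comm (M (j + 1) *ᵥ x)]
      ring
    have h1 := hcross x (c := fun _ => 2) (κ := 2) zero_le_two (fun j _ => by simp)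
    rw [e]
    set S := ∑ j ∈ Finset.range N, l ^ ((2 * j + 1) ^ 2) *
        (2 * ((M j *ᵥ x) ⬝ᵥ (M (j + 1) *ᵥ x)))
    have h2 := le_abs_self S
    have h3 : 4 * |S| ≤ l * |S| := mul_le_mul_of_nonneg_right hl (abs_nonneg _)
    linarith [hT0 x hx]
  have hPG : ∀ x, |x ⬝ᵥ (P *ᵥ (G *ᵥ x)) - ∑ j ∈ Finset.range N,
      l ^ (4 * j ^ 2) * ((1 + ν * j) * ((M j *ᵥ x) ⬝ᵥ (M j *ᵥ x)))| ≤ T x / (2 * N) := by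
    intro x
    have e : x ⬝ᵥ (P *ᵥ (G *ᵥ x)) - ∑ j ∈ Finset.range N,
        l ^ (4 * j ^ 2) * ((1 + ν * j) * ((M j *ᵥ x) ⬝ᵥ (M j *ᵥ x))) =
        -∑ j ∈ Finset.range N, l ^ ((2 * j + 1) ^ 2) *
        (((1 + ν * j) + (1 + ν * (j + 1 : ℕ))) * ((M j *ᵥ x) ⬝ᵥ (M (j + 1) *ᵥ x))) := by
      rw [hPdef, dotProduct_ladderMatrix, ← Finset.sum_sub_distrib, ← Finset.sum_neg_distrib]
      refine Finset.sum_congr rfl fun j _ => ?_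
      rw [hMG, hMG, dotProduct_smul, dotProduct_smul, dotProduct_smul,
        dotProduct_comm (M (j + 1) *ᵥ x), smul_eq_mul, smul_eq_mul, smul_eq_mul]
      ring
    have h1 := hcross x (c := fun j => (1 + ν * j) + (1 + ν * (j + 1 : ℕ))) (κ := 2 * K)
      (by linarith) (fun j hj => by
        have := abs_add_le (1 + ν * (j : ℝ)) (1 + ν * ((j + 1 : ℕ) : ℝ))
        linarith [hg j hj.le, hg (j + 1) hj])
    rw [e, abs_neg, le_div_iff₀ (by positivity)]
    rw [hldef] at h1 ⊢
    have hK2 : 0 < 2 * K := by linarith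
    refine le_of_mul_le_mul_left (le_trans (le_of_eq ?_) h1) hK2
    ring
  -- The diagonal part is at least T/N since every weight is at least 1/N, and the cross terms cost
  -- at most T/(2N).
  have hGpos : ∀ x, x ≠ 0 → 0 < x ⬝ᵥ (P *ᵥ (G *ᵥ x)) := by
    intro x hx
    have h1 : T x / N ≤ ∑ j ∈ Finset.range N,
        l ^ (4 * j ^ 2) * ((1 + ν * j) * ((M j *ᵥ x) ⬝ᵥ (M j *ᵥ x))) := by
      rw [Finset.sum_div]
      refine Finset.sum_le_sum fun j hj => ?_
      have h2 := one_add_mul_pos hν (Finset.mem_range.1 hj)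
      rw [div_eq_mul_one_div, mul_assoc, mul_comm _ (1 / (N : ℝ))]
      exact mul_le_mul_of_nonneg_left
        (mul_le_mul_of_nonneg_right h2 (dotProduct_self_nonneg_real _)) (by positivity)
    have h2 := (abs_le.1 (hPG x)).1
    have h3 : T x / N - T x / (2 * N) = T x / (2 * N) := by field_simp; ring
    have h4 : 0 < T x / (2 * N) := div_pos (hT0 x hx) (by positivity)
    linarith
  have hGle : ∀ x, x ⬝ᵥ (P *ᵥ (G *ᵥ x)) ≤ 2 * K * T x := by
    intro x
    have hTx : 0 ≤ T x := by
      rcases eq_or_ne x 0 with rfl | hx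
      · simp [T]
      · exact (hT0 x hx).le
    have h1 : ∑ j ∈ Finset.range N,
        l ^ (4 * j ^ 2) * ((1 + ν * j) * ((M j *ᵥ x) ⬝ᵥ (M j *ᵥ x))) ≤ K * T x := by
      rw [Finset.mul_sum]
      refine Finset.sum_le_sum fun j hj => ?_
      have h2 := (le_abs_self _).trans (hg j (Finset.mem_range.1 hj).le)
      rw [mul_left_comm]
      exact mul_le_mul_of_nonneg_right h2
        (mul_nonneg (by positivity) (dotProduct_self_nonneg_real _))
    have h2 := (abs_le.1 (hPG x)).2
    have h3 : T x / (2 * N) ≤ T x := div_le_self hTx (by linarith)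
    nlinarith
  let S : (Fin n → ℝ) → ℝ := fun x =>
    ∑ j ∈ Finset.range N, l ^ (4 * (j * (j - 1))) * ((M j *ᵥ x) ⬝ᵥ (M j *ᵥ x))
  -- The exponents differ by 4j² - 4j(j-1) = 4j ≤ 4N.
  have hTS : ∀ x, T x ≤ l ^ (4 * N) * S x := by
    intro x
    rw [Finset.mul_sum]
    refine Finset.sum_le_sum fun j hj => ?_
    rw [← mul_assoc, ← pow_add]
    refine mul_le_mul_of_nonneg_right (pow_le_pow_right₀ hl1 ?_) (dotProduct_self_nonneg_real _)
    have hj := Finset.mem_range.1 hj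
    cases j with
    | zero => simp
    | succ i => simp only [Nat.add_sub_cancel]; nlinarith
  have hS0 : ∀ x, 0 ≤ S x := fun x => Finset.sum_nonneg fun j _ =>
    mul_nonneg (by positivity) (dotProduct_self_nonneg_real _)
  have hPA : ∀ x, 2 * (x ⬝ᵥ (P *ᵥ (A₀ *ᵥ x))) ≤
      θ * (8 * ((C *ᵥ x) ⬝ᵥ (C *ᵥ x)) - 4 * S x) := by
    intro x
    have h1 := ladder_derivative_le (u := fun j => M j *ᵥ x) hl hN
      (fun j hj => by simp [hMN j hj])
    rw [hM0] at h1
    have e : x ⬝ᵥ (P *ᵥ (A₀ *ᵥ x)) = θ * ∑ j ∈ Finset.range N,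
        (l ^ (4 * j ^ 2) * ((M j *ᵥ x) ⬝ᵥ (M (j + 1) *ᵥ x)) -
        l ^ ((2 * j + 1) ^ 2) * ((M j *ᵥ x) ⬝ᵥ (M (j + 2) *ᵥ x) +
          (M (j + 1) *ᵥ x) ⬝ᵥ (M (j + 1) *ᵥ x))) := by
      rw [hPdef, dotProduct_ladderMatrix, Finset.mul_sum]
      refine Finset.sum_congr rfl fun j _ => ?_
      rw [hMA, hMA, dotProduct_smul, dotProduct_smul, dotProduct_smul, smul_eq_mul, smul_eq_mul,
        smul_eq_mul]
      ring
    rw [e, mul_left_comm]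
    exact mul_le_mul_of_nonneg_left h1 hθ0.le
  have hYT : ((-4 * θ) • Cᵀ * C)ᵀ = (-4 * θ) • Cᵀ * C := by
    rw [transpose_mul, transpose_smul, transpose_transpose, Matrix.mul_smul, Matrix.smul_mul]
  have hYT' : Cᵀ * ((-4 * θ) • Cᵀ)ᵀ = (-4 * θ) • Cᵀ * C := by
    rw [← hYT, transpose_mul]
  -- With this `Y`, the terms YC + CᵀYᵀ contribute -8θ|Cx|², which cancels the only positive term in
  -- `hPA`.
  refine ⟨P, (-4 * θ) • Cᵀ, ?_, ?_, posDef_of_transpose_eq hPT hPpos⟩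
  · refine posSemidef_of_transpose_eq ?_ fun x => ?_
    · rw [hYT', transpose_neg, transpose_add, transpose_add, transpose_add, transpose_smul, hYT,
        transpose_lyapunov hPT, transpose_lyapunov hPT]
    · rw [hYT', neg_mulVec, dotProduct_neg, neg_nonneg, add_mulVec, add_mulVec, add_mulVec,
        dotProduct_add, dotProduct_add, dotProduct_add, dotProduct_lyapunov hPT, smul_mulVec,
        dotProduct_smul, dotProduct_lyapunov hPT, Matrix.smul_mul, smul_mulVec, dotProduct_smul,
        dotProduct_transpose_mul_mulVec, smul_eq_mul, smul_eq_mul]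
      have h1 := hPA x
      have h2 : ρ * (2 * (x ⬝ᵥ (P *ᵥ (G *ᵥ x)))) ≤ ρ * (2 * (2 * K * (l ^ (4 * N) * S x))) := by
        have := (hGle x).trans (mul_le_mul_of_nonneg_left (hTS x) (by linarith : 0 ≤ 2 * K))
        exact mul_le_mul_of_nonneg_left (by linarith) hρ.le
      have h3 : ρ * (2 * (2 * K * (l ^ (4 * N) * S x))) ≤ θ * (4 * S x) := by
        have h4 : 0 ≤ ρ * K * l ^ (4 * N) * S x :=
          mul_nonneg (by positivity) (hS0 x)
        have e : θ * (4 * S x) = 4 * S x + 12 * (ρ * K * l ^ (4 * N) * S x) := by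
          rw [hθdef]; ring
        rw [e]
        linarith [hS0 x]
      linarith
  · refine posDef_of_transpose_eq (transpose_lyapunov hPT G) fun x hx => ?_
    rw [dotProduct_lyapunov hPT]
    linarith [hGpos x hx]

end LMI

/-! ### One-parameter matrix groups and derivatives along them. -/

section MatrixExponential

variable {n : ℕ}

open scoped Matrix.Norms.Operator in
theorem hasDerivAt_expGroup_apply (G : Matrix (Fin n) (Fin n) ℝ) (s : ℝ) (i j : Fin n) :
    HasDerivAt (fun s => expGroup G s i j) ((G * expGroup G s) i j) s := by
  have h : HasDerivAt (fun u : ℝ => NormedSpace.exp (u • G)) (G * NormedSpace.exp (s • G)) s :=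
    hasDerivAt_exp_smul_const' G s
  exact hasDerivAt_pi.1 (hasDerivAt_pi.1 h i) j

theorem expGroup_add (G : Matrix (Fin n) (Fin n) ℝ) (s t : ℝ) :
    expGroup G (s + t) = expGroup G s * expGroup G t := by
  rw [expGroup, add_smul]
  exact Matrix.exp_add_of_commute _ _ (((Commute.refl G).smul_left s).smul_right t)

theorem expGroup_zero (G : Matrix (Fin n) (Fin n) ℝ) : expGroup G 0 = 1 := by
  rw [expGroup, zero_smul, NormedSpace.exp_zero]

open scoped Matrix.Norms.Operator in
theorem SemiconjBy.expGroup {A G G' : Matrix (Fin n) (Fin n) ℝ} (h : SemiconjBy A G G') (s : ℝ) :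
    SemiconjBy A (expGroup G s) (expGroup G' s) := by
  have h1 : SemiconjBy A (s • G) (s • G') := by
    simp only [SemiconjBy, Matrix.mul_smul, Matrix.smul_mul, h.eq]
  exact h1.exp_right

theorem expGroup_add_smul_one (G : Matrix (Fin n) (Fin n) ℝ) (c s : ℝ) :
    expGroup (G + c • 1) s = Real.exp (c * s) • expGroup G s := by
  have h : NormedSpace.exp ((c * s) • (1 : Matrix (Fin n) (Fin n) ℝ)) = Real.exp (c * s) • 1 := by
    rw [← Matrix.diagonal_one, ← Matrix.diagonal_smul, Matrix.exp_diagonal, ← Matrix.diagonal_smul]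
    congr 1
    ext i
    simp [Pi.coe_exp, Real.exp_eq_exp_ℝ]
  rw [expGroup, smul_add, smul_smul, mul_comm s c, Matrix.exp_add_of_commute _ _ ?_, h,
    Matrix.mul_smul, Matrix.mul_one]
  · rfl
  · exact (Commute.one_right _).smul_right _

theorem expGroup_mul_expGroup_neg (G : Matrix (Fin n) (Fin n) ℝ) (s : ℝ) :
    expGroup G s * expGroup G (-s) = 1 := by
  rw [← expGroup_add, add_neg_cancel, expGroup_zero]

theorem HasDerivAt.dotProduct {f g : ℝ → Fin n → ℝ} {f' g' : Fin n → ℝ} {t : ℝ}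
    (hf : HasDerivAt f f' t) (hg : HasDerivAt g g' t) :
    HasDerivAt (fun t => f t ⬝ᵥ g t) (f' ⬝ᵥ g t + f t ⬝ᵥ g') t := by
  have h := HasDerivAt.fun_sum (u := Finset.univ) fun i _ =>
    (hasDerivAt_pi.1 hf i).mul (hasDerivAt_pi.1 hg i)
  rwa [Finset.sum_add_distrib] at h

theorem HasDerivAt.matrix_mulVec {M : ℝ → Matrix (Fin n) (Fin n) ℝ}
    {M' : Matrix (Fin n) (Fin n) ℝ} {f : ℝ → Fin n → ℝ} {f' : Fin n → ℝ} {t : ℝ}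
    (hM : ∀ i j, HasDerivAt (fun t => M t i j) (M' i j) t) (hf : HasDerivAt f f' t) :
    HasDerivAt (fun t => M t *ᵥ f t) (M' *ᵥ f t + M t *ᵥ f') t :=
  hasDerivAt_pi.2 fun i => HasDerivAt.dotProduct (hasDerivAt_pi.2 fun j => hM i j) hf

theorem HasDerivAt.const_mulVec (M : Matrix (Fin n) (Fin n) ℝ) {f : ℝ → Fin n → ℝ}
    {f' : Fin n → ℝ} {t : ℝ} (hf : HasDerivAt f f' t) :
    HasDerivAt (fun t => M *ᵥ f t) (M *ᵥ f') t := by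
  have h := HasDerivAt.matrix_mulVec (M := fun _ => M) (M' := 0)
    (fun i j => hasDerivAt_const t (M i j)) hf
  rwa [zero_mulVec, zero_add] at h

theorem HasDerivAt.quadraticForm {P : Matrix (Fin n) (Fin n) ℝ} (hP : Pᵀ = P)
    {f : ℝ → Fin n → ℝ} {f' : Fin n → ℝ} {t : ℝ} (hf : HasDerivAt f f' t) :
    HasDerivAt (fun t => f t ⬝ᵥ (P *ᵥ f t)) (2 * (f t ⬝ᵥ (P *ᵥ f'))) t := by
  have h := hf.dotProduct (hf.const_mulVec P)
  rwa [dotProduct_mulVec f', ← mulVec_transpose, hP, dotProduct_comm (P *ᵥ f'), ← two_mul] at h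

theorem HasDerivAt.expGroup_mulVec (G : Matrix (Fin n) (Fin n) ℝ) {σ : ℝ → ℝ} {σ' t : ℝ}
    {f : ℝ → Fin n → ℝ} {f' : Fin n → ℝ} (hσ : HasDerivAt σ σ' t) (hf : HasDerivAt f f' t) :
    HasDerivAt (fun t => expGroup G (σ t) *ᵥ f t)
      (σ' • (G *ᵥ (expGroup G (σ t) *ᵥ f t)) + expGroup G (σ t) *ᵥ f') t := by
  have h := HasDerivAt.matrix_mulVec (M := fun t => expGroup G (σ t))
    (M' := σ' • (G * expGroup G (σ t)))
    (fun i j => by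
      rw [Matrix.smul_apply, smul_eq_mul, mul_comm]
      exact (hasDerivAt_expGroup_apply G (σ t) i j).comp t hσ) hf
  rwa [smul_mulVec, ← mulVec_mulVec] at h

theorem continuous_expGroup (G : Matrix (Fin n) (Fin n) ℝ) : Continuous (expGroup G) :=
  continuous_matrix fun i j => continuous_iff_continuousAt.2 fun s =>
    (hasDerivAt_expGroup_apply G s i j).continuousAt

/-- The derivative of the form along the flow is 2yᵀPGy at the current point y. -/
theorem monotone_quadraticForm_expGroup {P G : Matrix (Fin n) (Fin n) ℝ} (hP : Pᵀ = P)
    (h : ∀ x : Fin n → ℝ, 0 ≤ x ⬝ᵥ (P *ᵥ (G *ᵥ x))) (x : Fin n → ℝ) :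
    Monotone fun s => (expGroup G s *ᵥ x) ⬝ᵥ (P *ᵥ (expGroup G s *ᵥ x)) := by
  have hd : ∀ s, HasDerivAt (fun s => (expGroup G s *ᵥ x) ⬝ᵥ (P *ᵥ (expGroup G s *ᵥ x)))
      (2 * ((expGroup G s *ᵥ x) ⬝ᵥ (P *ᵥ (G *ᵥ (expGroup G s *ᵥ x))))) s := fun s => by
    have h1 := HasDerivAt.expGroup_mulVec G (hasDerivAt_id s) (hasDerivAt_const s x)
    rw [one_smul, mulVec_zero, add_zero] at h1
    exact h1.quadraticForm hP
  exact monotone_of_deriv_nonneg (fun s => (hd s).differentiableAt) fun s => by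
    rw [(hd s).deriv]
    exact mul_nonneg zero_le_two (h _)

end MatrixExponential

/-! ### Dilations generated by matrices that are monotone for a quadratic form. -/

section Dilation

variable {n : ℕ}

theorem transpose_eq_of_posDef {P : Matrix (Fin n) (Fin n) ℝ} (hP : P.PosDef) : Pᵀ = P := by
  have := hP.isHermitian
  rwa [Matrix.IsHermitian, conjTranspose_eq_transpose_of_trivial] at this

theorem quadraticForm_smul (P : Matrix (Fin n) (Fin n) ℝ) (r : ℝ) (x : Fin n → ℝ) :
    (r • x) ⬝ᵥ (P *ᵥ (r • x)) = r ^ 2 * (x ⬝ᵥ (P *ᵥ x)) := by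
  rw [mulVec_smul, dotProduct_smul, smul_dotProduct, smul_eq_mul, smul_eq_mul]
  ring

theorem continuous_quadraticForm (P : Matrix (Fin n) (Fin n) ℝ) :
    Continuous fun x : Fin n → ℝ => x ⬝ᵥ (P *ᵥ x) := by
  fun_prop

theorem exists_mul_sq_norm_le_quadraticForm {Q : Matrix (Fin n) (Fin n) ℝ} (hQ : Q.PosDef) :
    ∃ c > 0, ∀ x : Fin n → ℝ, c * ‖x‖ ^ 2 ≤ x ⬝ᵥ (Q *ᵥ x) := by
  have hpos : ∀ x : Fin n → ℝ, x ≠ 0 → 0 < x ⬝ᵥ (Q *ᵥ x) := fun x hx => by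
    simpa using hQ.dotProduct_mulVec_pos hx
  have key : ∃ c > 0, ∀ y ∈ Metric.sphere (0 : Fin n → ℝ) 1, c ≤ y ⬝ᵥ (Q *ᵥ y) := by
    -- The sphere is empty for n = 0, where any positive constant serves.
    rcases (Metric.sphere (0 : Fin n → ℝ) 1).eq_empty_or_nonempty with he | hne
    · exact ⟨1, one_pos, by simp [he]⟩
    · obtain ⟨y, hy, hmin⟩ := (isCompact_sphere (0 : Fin n → ℝ) 1).exists_isMinOn hne
        (continuous_quadraticForm Q).continuousOn
      refine ⟨y ⬝ᵥ (Q *ᵥ y), hpos y ?_, fun z hz => hmin hz⟩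
      rintro rfl
      simp at hy
  obtain ⟨c, hc, h⟩ := key
  refine ⟨c, hc, fun x => ?_⟩
  rcases eq_or_ne x 0 with rfl | hx
  · simp
  · have hx' : ‖x‖ ≠ 0 := norm_ne_zero_iff.2 hx
    have h1 := h (‖x‖⁻¹ • x) (by simp [norm_smul, hx'])
    have h2 : x = ‖x‖ • (‖x‖⁻¹ • x) := by rw [smul_smul, mul_inv_cancel₀ hx', one_smul]
    conv_rhs => rw [h2, quadraticForm_smul]
    rw [mul_comm]
    gcongr

theorem exists_quadraticForm_le_mul_sq_norm (P : Matrix (Fin n) (Fin n) ℝ) :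
    ∃ c > 0, ∀ x : Fin n → ℝ, x ⬝ᵥ (P *ᵥ x) ≤ c * ‖x‖ ^ 2 := by
  obtain ⟨c, hc⟩ := (isCompact_sphere (0 : Fin n → ℝ) 1).bddAbove_image
    (continuous_quadraticForm P).continuousOn
  -- The upper bound over the sphere need not be positive, since `P` is arbitrary here.
  refine ⟨max c 1, by positivity, fun x => ?_⟩
  rcases eq_or_ne x 0 with rfl | hx
  · simp
  · have hx' : ‖x‖ ≠ 0 := norm_ne_zero_iff.2 hx
    have h1 := hc ⟨‖x‖⁻¹ • x, by simp [norm_smul, hx'], rfl⟩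
    have h2 : x = ‖x‖ • (‖x‖⁻¹ • x) := by rw [smul_smul, mul_inv_cancel₀ hx', one_smul]
    conv_lhs => rw [h2, quadraticForm_smul]
    rw [mul_comm]
    exact mul_le_mul_of_nonneg_right (h1.trans (le_max_left _ _)) (by positivity)

/-- Exponential monotonicity of the quadratic form of `P` along `s ↦ exp (s G)`. -/
theorem exists_monotone_exp_mul_quadraticForm {P G : Matrix (Fin n) (Fin n) ℝ} (hP : P.PosDef)
    (hPG : (P * G + Gᵀ * P).PosDef) : ∃ c > 0, ∀ x : Fin n → ℝ, Monotone fun s =>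
      Real.exp (-c * s) * ((expGroup G s *ᵥ x) ⬝ᵥ (P *ᵥ (expGroup G s *ᵥ x))) := by
  have hPT := transpose_eq_of_posDef hP
  obtain ⟨a, ha, hQ⟩ := exists_mul_sq_norm_le_quadraticForm hPG
  obtain ⟨b, hb, hPb⟩ := exists_quadraticForm_le_mul_sq_norm P
  refine ⟨a / b, div_pos ha hb, fun x => ?_⟩
  -- Shifting the generator by -(a/b)/2 multiplies the quadratic form by exp(-(a/b)s). The shifted
  -- generator is still monotone because 2yᵀPGy ≥ a‖y‖² ≥ (a/b)yᵀPy.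
  have h := monotone_quadraticForm_expGroup (G := G + (-(a / b) / 2) • 1) hPT (fun y => by
    have h1 := hQ y
    rw [dotProduct_lyapunov hPT] at h1
    rw [add_mulVec, smul_mulVec, one_mulVec, mulVec_add, dotProduct_add, mulVec_smul,
      dotProduct_smul, smul_eq_mul]
    have h2 : a / b * (y ⬝ᵥ (P *ᵥ y)) ≤ a * ‖y‖ ^ 2 := by
      rw [div_mul_eq_mul_div, div_le_iff₀ hb]
      nlinarith [hPb y]
    linarith) x
  convert h using 2 with s
  rw [expGroup_add_smul_one, smul_mulVec, quadraticForm_smul, ← Real.exp_nat_mul]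
  congr 2
  push_cast
  ring

/-- Uniform decay of `exp (s G) x` as `s → -∞`, in terms of the quadratic form of `x`. -/
theorem exists_sq_norm_expGroup_le {P G : Matrix (Fin n) (Fin n) ℝ} (hP : P.PosDef)
    (hPG : (P * G + Gᵀ * P).PosDef) : ∃ c > 0, ∃ b, ∀ x : Fin n → ℝ, ∀ s ≤ 0,
      ‖expGroup G s *ᵥ x‖ ^ 2 ≤ b * Real.exp (c * s) * (x ⬝ᵥ (P *ᵥ x)) := by
  obtain ⟨c, hc, hmono⟩ := exists_monotone_exp_mul_quadraticForm hP hPG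
  obtain ⟨a, ha, hPa⟩ := exists_mul_sq_norm_le_quadraticForm hP
  refine ⟨c, hc, a⁻¹, fun x s hs => ?_⟩
  have h := hmono x hs
  simp only [mul_zero, Real.exp_zero, one_mul, expGroup_zero, one_mulVec] at h
  rw [neg_mul, Real.exp_neg, inv_mul_le_iff₀ (Real.exp_pos _)] at h
  rw [mul_assoc, ← div_eq_inv_mul, le_div_iff₀ ha, mul_comm]
  exact (hPa _).trans h

theorem isDilation_expGroup {P G : Matrix (Fin n) (Fin n) ℝ} (hP : P.PosDef)
    (hPG : (P * G + Gᵀ * P).PosDef) : IsDilation (expGroup G) where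
  zero := expGroup_zero G
  add := expGroup_add G
  continuous := continuous_expGroup G
  expand x hx := by
    obtain ⟨c, hc, hmono⟩ := exists_monotone_exp_mul_quadraticForm hP hPG
    obtain ⟨b, hb, hPb⟩ := exists_quadraticForm_le_mul_sq_norm P
    have hx0 : 0 < x ⬝ᵥ (P *ᵥ x) := by simpa using hP.dotProduct_mulVec_pos hx
    have h1 : ∀ s, 0 ≤ s → b⁻¹ * (x ⬝ᵥ (P *ᵥ x)) * Real.exp (c * s) ≤
        ‖expGroup G s *ᵥ x‖ ^ 2 := fun s hs => by
      have h := hmono x hs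
      simp only [mul_zero, Real.exp_zero, one_mul, expGroup_zero, one_mulVec] at h
      rw [neg_mul, Real.exp_neg, le_inv_mul_iff₀ (Real.exp_pos _)] at h
      rw [mul_assoc, inv_mul_le_iff₀ hb, mul_comm (_ ⬝ᵥ _)]
      exact h.trans (hPb _)
    have h2 : Tendsto (fun s => ‖expGroup G s *ᵥ x‖ ^ 2) atTop atTop := by
      refine tendsto_atTop_mono' _ ((eventually_ge_atTop 0).mono h1) ?_
      exact (Real.tendsto_exp_atTop.comp (tendsto_id.const_mul_atTop hc)).const_mul_atTop
        (by positivity)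
    have h3 := Real.tendsto_sqrt_atTop.comp h2
    simpa only [Function.comp_def, Real.sqrt_sq (norm_nonneg _)] using h3
  contract x _ := by
    obtain ⟨c, hc, b, h⟩ := exists_sq_norm_expGroup_le hP hPG
    have h1 : Tendsto (fun s => b * Real.exp (c * s) * (x ⬝ᵥ (P *ᵥ x))) atBot (𝓝 0) := by
      have := (((Real.tendsto_exp_atBot.comp (tendsto_id.const_mul_atBot hc)).const_mul b).mul_const
        (x ⬝ᵥ (P *ᵥ x)))
      simpa [Function.comp_def] using this
    have h2 : Tendsto (fun s => ‖expGroup G s *ᵥ x‖ ^ 2) atBot (𝓝 0) :=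
      tendsto_of_tendsto_of_tendsto_of_le_of_le' tendsto_const_nhds h1
        (Eventually.of_forall fun s => by positivity) ((eventually_le_atBot 0).mono (h x))
    have h3 := h2.sqrt
    simpa only [Real.sqrt_sq (norm_nonneg _), Real.sqrt_zero] using h3

theorem extGroup_mulVec (G : Matrix (Fin n) (Fin n) ℝ) (s : ℝ) (e : Fin n ⊕ Unit → ℝ) :
    extGroup G s *ᵥ e = Sum.elim (expGroup G s *ᵥ (e ∘ Sum.inl))
      (fun _ => Real.exp s * e (Sum.inr ())) := by
  rw [extGroup, fromBlocks_mulVec]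
  congr 1
  · simp
  · ext i
    simp [smul_mulVec]

theorem norm_sumElim_unit (v : Fin n → ℝ) (r : ℝ) :
    ‖(Sum.elim v fun _ => r : Fin n ⊕ Unit → ℝ)‖ = max ‖v‖ |r| := by
  refine le_antisymm ?_ (max_le ?_ ?_)
  · refine (pi_norm_le_iff_of_nonneg (by positivity)).2 ?_
    rintro (i | i)
    · exact (norm_le_pi_norm v i).trans (le_max_left _ _)
    · exact le_max_right ‖v‖ |r|
  · refine (pi_norm_le_iff_of_nonneg (norm_nonneg _)).2 fun i => ?_
    exact norm_le_pi_norm (Sum.elim v fun _ => r : Fin n ⊕ Unit → ℝ) (Sum.inl i)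
  · exact norm_le_pi_norm (Sum.elim v fun _ => r : Fin n ⊕ Unit → ℝ) (Sum.inr ())

theorem isDilation_extGroup {G : Matrix (Fin n) (Fin n) ℝ} (h : IsDilation (expGroup G)) :
    IsDilation (extGroup G) where
  zero := by simp [extGroup, h.zero]
  add s t := by
    rw [extGroup, extGroup, extGroup, fromBlocks_multiply, h.add, Real.exp_add]
    simp [mul_smul, smul_comm (Real.exp s)]
  continuous := by
    refine h.continuous.matrix_fromBlocks continuous_const continuous_const ?_
    exact Real.continuous_exp.smul continuous_const
  expand e he := by
    simp only [extGroup_mulVec, norm_sumElim_unit]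
    by_cases hl : e ∘ Sum.inl = 0
    · have hr : e (Sum.inr ()) ≠ 0 := fun hr => he <| by
        ext (i | i)
        · exact congrFun hl i
        · exact hr
      refine tendsto_atTop_mono (fun s => le_max_right _ _) ?_
      simp only [abs_mul, Real.abs_exp]
      exact Real.tendsto_exp_atTop.atTop_mul_const (abs_pos.2 hr)
    · exact tendsto_atTop_mono (fun s => le_max_left _ _) (h.expand _ hl)
  contract e _ := by
    simp only [extGroup_mulVec, norm_sumElim_unit]
    have h1 : Tendsto (fun s => ‖expGroup G s *ᵥ (e ∘ Sum.inl)‖) atBot (𝓝 0) := by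
      by_cases hl : e ∘ Sum.inl = 0
      · simp [hl]
      · exact h.contract _ hl
    have h2 : Tendsto (fun s => |Real.exp s * e (Sum.inr ())|) atBot (𝓝 0) := by
      have := (Real.tendsto_exp_atBot.mul_const (e (Sum.inr ()))).abs
      simpa using this
    simpa using h1.max h2

end Dilation

/-! ### Homogeneity of the error field. -/

section Homogeneity

variable {n k : ℕ}

theorem mul_expGroup_of_mul_eq {A G : Matrix (Fin n) (Fin n) ℝ} {ν : ℝ}
    (h : A * G = (G + ν • 1) * A) (s : ℝ) :
    A * expGroup G s = Real.exp (ν * s) • (expGroup G s * A) := by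
  have h1 := (SemiconjBy.expGroup (show SemiconjBy A G (G + ν • 1) from h) s).eq
  rwa [expGroup_add_smul_one, Matrix.smul_mul] at h1

/-- Intertwining of exponentials is available for square matrices, so it is applied to CᵀC, which
intertwines `G` with the identity. The factor Cᵀ is then cancelled, as CᵀCX = 0 forces CX = 0. -/
theorem mul_expGroup_of_mul_eq_self {C : Matrix (Fin k) (Fin n) ℝ} {G : Matrix (Fin n) (Fin n) ℝ}
    (h : C * G = C) (s : ℝ) : C * expGroup G s = Real.exp s • C := by
  have h1 : (Cᵀ * C) * G = (0 + (1 : ℝ) • 1) * (Cᵀ * C) := by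
    rw [Matrix.mul_assoc, h, zero_add, one_smul, one_mul]
  have h2 := (SemiconjBy.expGroup (show SemiconjBy (Cᵀ * C) G _ from h1) s).eq
  have h0 : expGroup (0 : Matrix (Fin n) (Fin n) ℝ) s = 1 := by
    rw [expGroup, smul_zero, NormedSpace.exp_zero]
  rw [expGroup_add_smul_one, h0, Matrix.smul_mul, one_mul, one_mul] at h2
  have h3 : Cᴴ * C * (expGroup G s - Real.exp s • 1) = 0 := by
    rw [conjTranspose_eq_transpose_of_trivial, Matrix.mul_sub, h2, Matrix.mul_smul,
      Matrix.mul_one, sub_self]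
  rw [conjTranspose_mul_self_mul_eq_zero, Matrix.mul_sub, Matrix.mul_smul, Matrix.mul_one,
    sub_eq_zero] at h3
  exact h3

theorem log_abs_exp_mul (s : ℝ) {ξ : ℝ} (hξ : ξ ≠ 0) :
    Real.log |Real.exp s * ξ| = s + Real.log |ξ| := by
  rw [abs_mul, Real.abs_exp, Real.log_mul (Real.exp_ne_zero _) (abs_ne_zero.2 hξ), Real.log_exp]

theorem abs_exp_mul_rpow (s ξ p : ℝ) :
    |Real.exp s * ξ| ^ p = Real.exp (p * s) * |ξ| ^ p := by
  rw [abs_mul, Real.abs_exp, Real.mul_rpow (Real.exp_pos _).le (abs_nonneg _), ← Real.exp_mul,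
    mul_comm s]

theorem sign_pos_mul {a : ℝ} (ha : 0 < a) (ξ : ℝ) : Real.sign (a * ξ) = Real.sign ξ := by
  rcases lt_trichotomy ξ 0 with h | rfl | h
  · rw [Real.sign_of_neg h, Real.sign_of_neg (mul_neg_of_pos_of_neg ha h)]
  · rw [mul_zero]
  · rw [Real.sign_of_pos h, Real.sign_of_pos (mul_pos ha h)]

theorem gain_exp_mul (G : Matrix (Fin n) (Fin n) ℝ) (L : Matrix (Fin n) (Fin k) ℝ) (ν s : ℝ)
    {ξ : ℝ} (hξ : ξ ≠ 0) :
    gain G L ν (Real.exp s * ξ) = Real.exp ((ν - 1) * s) • (expGroup G s * gain G L ν ξ) := by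
  rw [gain, gain, log_abs_exp_mul s hξ, abs_exp_mul_rpow, expGroup_add, Matrix.mul_smul, mul_smul,
    Matrix.mul_assoc]

theorem xiField_exp_mul (ρ ν s ξ : ℝ) :
    xiField ρ ν (Real.exp s * ξ) = Real.exp ((1 + ν) * s) * xiField ρ ν ξ := by
  rw [xiField, xiField, abs_exp_mul_rpow, sign_pos_mul (Real.exp_pos s)]
  ring

/-- The scaling e^{(ν-1)s} of the gain and e^s of the output combine to e^{νs}, matching the scaling
of A₀. -/
theorem isHomogeneousOn_errorField {A₀ G : Matrix (Fin n) (Fin n) ℝ} {C : Matrix (Fin k) (Fin n) ℝ}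
    {ν : ℝ} (hA : A₀ * G = (G + ν • 1) * A₀) (hC : C * G = C) (L : Matrix (Fin n) (Fin k) ℝ)
    (ρ : ℝ) :
    IsHomogeneousOn (extGroup G) (errorField A₀ C G L ρ ν) ν {e | e (Sum.inr ()) ≠ 0} := by
  intro s e he
  have he' : e (Sum.inr ()) ≠ 0 := he
  rw [extGroup_mulVec, extGroup_mulVec]
  refine ⟨mul_ne_zero (Real.exp_ne_zero s) he', ?_⟩
  have hε : (errorField A₀ C G L ρ ν e) ∘ Sum.inl = A₀ *ᵥ (e ∘ Sum.inl) +
      gain G L ν (e (Sum.inr ())) *ᵥ (C *ᵥ (e ∘ Sum.inl)) := rfl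
  have hξ : errorField A₀ C G L ρ ν e (Sum.inr ()) = xiField ρ ν (e (Sum.inr ())) := rfl
  rw [hε, hξ]
  ext (i | i)
  · change (A₀ *ᵥ (expGroup G s *ᵥ (e ∘ Sum.inl)) + gain G L ν (Real.exp s * e (Sum.inr ())) *ᵥ
      (C *ᵥ (expGroup G s *ᵥ (e ∘ Sum.inl)))) i = (Real.exp (ν * s) • (expGroup G s *ᵥ
        (A₀ *ᵥ (e ∘ Sum.inl) + gain G L ν (e (Sum.inr ())) *ᵥ (C *ᵥ (e ∘ Sum.inl))))) i
    refine congrFun ?_ i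
    rw [gain_exp_mul G L ν s he', mulVec_mulVec _ A₀, mulVec_mulVec _ C,
      mul_expGroup_of_mul_eq hA, mul_expGroup_of_mul_eq_self hC, smul_mulVec, smul_mulVec,
      smul_mulVec, mulVec_smul, smul_smul, ← Real.exp_add, ← mulVec_mulVec, ← mulVec_mulVec,
      mulVec_add, smul_add]
    congr 3
    ring
  · change xiField ρ ν (Real.exp s * e (Sum.inr ())) =
      Real.exp (ν * s) * (Real.exp s * xiField ρ ν (e (Sum.inr ())))
    rw [xiField_exp_mul, ← mul_assoc, ← Real.exp_add]
    congr 2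
    ring

/-- The dilation conjugates the time-varying error system to a time-invariant one. -/
theorem errorMatrix_mul_expGroup {A₀ G : Matrix (Fin n) (Fin n) ℝ} {C : Matrix (Fin k) (Fin n) ℝ}
    {ν : ℝ} (hA : A₀ * G = (G + ν • 1) * A₀) (hC : C * G = C) (L : Matrix (Fin n) (Fin k) ℝ)
    {ξ : ℝ} (hξ : ξ ≠ 0) :
    (A₀ + gain G L ν ξ * C) * expGroup G (Real.log |ξ|) =
      |ξ| ^ ν • (expGroup G (Real.log |ξ|) * (A₀ + L * C)) := by
  have h0 : 0 < |ξ| := abs_pos.2 hξ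
  rw [add_mul, mul_expGroup_of_mul_eq hA, Matrix.mul_assoc, mul_expGroup_of_mul_eq_self hC,
    Real.exp_log h0, mul_comm ν, ← Real.rpow_def_of_pos h0, gain, Matrix.smul_mul,
    Matrix.mul_smul, smul_smul, Matrix.mul_add, smul_add, Matrix.mul_assoc, Real.rpow_sub_one h0.ne',
    div_mul_cancel₀ _ h0.ne']

theorem continuousOn_gain (G : Matrix (Fin n) (Fin n) ℝ) (L : Matrix (Fin n) (Fin k) ℝ) (ν : ℝ)
    {ξ : ℝ → ℝ} {S : Set ℝ} (hξ : ContinuousOn ξ S) (h0 : ∀ t ∈ S, ξ t ≠ 0) :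
    ContinuousOn (fun t => gain G L ν (ξ t)) S := by
  have h0' : ∀ t ∈ S, |ξ t| ≠ 0 := fun t ht => abs_ne_zero.2 (h0 t ht)
  refine (hξ.abs.rpow_const fun t ht => Or.inl (h0' t ht)).smul ?_
  exact (Continuous.matrix_mul (continuous_expGroup G) continuous_const).comp_continuousOn
    (hξ.abs.log h0')

end Homogeneity

/-! ### Carathéodory solutions and comparison for antitone fields. -/

section Solutions

variable {E : Type*} [NormedAddCommGroup E] [NormedSpace ℝ E]

theorem IsSolutionOn.continuousOn {J : Set ℝ} {f : ℝ → E → E} {w : ℝ → E}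
    (h : IsSolutionOn J f w) {T : ℝ} (hT : 0 ≤ T) (hJ : Set.Icc 0 T ⊆ J) :
    ContinuousOn w (Set.Icc 0 T) := by
  have hi := (h T (hJ ⟨hT, le_rfl⟩)).1
  have h1 : ContinuousOn (fun t => w 0 + ∫ s in (0 : ℝ)..t, f s (w s)) (Set.Icc 0 T) := by
    have := intervalIntegral.continuousOn_primitive_interval' hi Set.left_mem_uIcc
    rw [Set.uIcc_of_le hT] at this
    exact continuousOn_const.add this
  exact h1.congr fun t ht => (h t (hJ ht)).2

theorem IsSolutionOn.hasDerivAt [CompleteSpace E] {J : Set ℝ} {f : ℝ → E → E} {w : ℝ → E}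
    (h : IsSolutionOn J f w) {T : ℝ} (hJ : Set.Icc 0 T ⊆ J)
    (hc : ContinuousOn (fun s => f s (w s)) (Set.Icc 0 T)) {t : ℝ} (ht : t ∈ Set.Ioo 0 T) :
    HasDerivAt w (f t (w t)) t := by
  have hi := (h t (hJ ⟨ht.1.le, ht.2.le⟩)).1
  have hc' : ContinuousOn (fun s => f s (w s)) (Set.Ioo 0 T) := hc.mono Set.Ioo_subset_Icc_self
  have h1 := (intervalIntegral.integral_hasDerivAt_right hi
    (hc'.stronglyMeasurableAtFilter isOpen_Ioo t ht)
    (hc'.continuousAt (isOpen_Ioo.mem_nhds ht))).const_add (w 0)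
  refine h1.congr_of_eventuallyEq ?_
  filter_upwards [isOpen_Ioo.mem_nhds ht] with s hs
  exact (h s (hJ ⟨hs.1.le, hs.2.le⟩)).2

theorem isSolutionOn_of_hasDerivAt [CompleteSpace E] {J : Set ℝ} {f : ℝ → E → E} {w : ℝ → E}
    (hJ : ∀ t ∈ J, 0 ≤ t ∧ Set.Icc 0 t ⊆ J) (hw : ∀ t ∈ J, HasDerivAt w (f t (w t)) t)
    (hc : ContinuousOn (fun s => f s (w s)) J) : IsSolutionOn J f w := by
  intro t ht
  obtain ⟨h0, hsub⟩ := hJ t ht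
  have hu : Set.uIcc 0 t ⊆ J := by rwa [Set.uIcc_of_le h0]
  have hi : IntervalIntegrable (fun s => f s (w s)) volume 0 t :=
    (hc.mono hu).intervalIntegrable
  refine ⟨hi, ?_⟩
  rw [intervalIntegral.integral_eq_sub_of_hasDerivAt (fun s hs => hw s (hu hs)) hi]
  abel

/-- A Carathéodory solution of a scalar autonomous equation with an antitone field stays below
any other one that starts at the same point. -/
theorem IsSolutionOn.le_of_antitone {J : Set ℝ} {f : ℝ → ℝ} (hf : Antitone f) {x y : ℝ → ℝ}
    (hJ : ∀ t ∈ J, 0 ≤ t ∧ Set.Icc 0 t ⊆ J)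
    (hx : IsSolutionOn J (fun _ => f) x) (hy : IsSolutionOn J (fun _ => f) y) (h0 : x 0 = y 0)
    {t : ℝ} (ht : t ∈ J) : x t ≤ y t := by
  obtain ⟨ht0, hsub⟩ := hJ t ht
  by_contra! hlt
  have hcx := hx.continuousOn ht0 hsub
  have hcy := hy.continuousOn ht0 hsub
  set Z : Set ℝ := {s ∈ Set.Icc 0 t | x s ≤ y s} with hZ
  have hZc : IsClosed Z := isClosed_Icc.isClosed_le hcx hcy
  have hZn : Z.Nonempty := ⟨0, ⟨le_rfl, ht0⟩, h0.le⟩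
  have hZb : BddAbove Z := ⟨t, fun s hs => hs.1.2⟩
  have hs := hZc.csSup_mem hZn hZb
  -- After the last time s with x ≤ y, x stays above y, so f(x) ≤ f(y) there. Then x gains no more
  -- than y on [s, t], contradicting x t > y t.
  set s := sSup Z
  have hgt : ∀ r ∈ Set.Ioc s t, y r ≤ x r := fun r hr => by
    by_contra! hr'
    exact absurd (le_csSup hZb ⟨⟨hs.1.1.trans hr.1.le, hr.2⟩, hr'.le⟩) (not_le.2 hr.1)
  have hsJ := hsub hs.1
  have ix := ((hx s hsJ).1.symm.trans (hx t ht).1)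
  have iy := ((hy s hsJ).1.symm.trans (hy t ht).1)
  have ex : x t = x s + ∫ r in s..t, f (x r) := by
    rw [(hx t ht).2, (hx s hsJ).2, add_assoc,
      intervalIntegral.integral_add_adjacent_intervals (hx s hsJ).1 ix]
  have ey : y t = y s + ∫ r in s..t, f (y r) := by
    rw [(hy t ht).2, (hy s hsJ).2, add_assoc,
      intervalIntegral.integral_add_adjacent_intervals (hy s hsJ).1 iy]
  have hle : ∫ r in s..t, f (x r) ≤ ∫ r in s..t, f (y r) := by
    refine intervalIntegral.integral_mono_on_of_le_Ioo hs.1.2 ix iy fun r hr => ?_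
    exact hf (hgt r ⟨hr.1, hr.2.le⟩)
  linarith [hs.2]

end Solutions

/-! ### The scalar equation for ξ and its explicit solution. -/

section ScalarEquation

variable {ρ ν : ℝ}

/-- Monotonicity stands in for Lipschitz continuity, which fails at ξ = 0 when ν < 0. -/
theorem antitone_xiField (hρ : 0 ≤ ρ) (hν : 0 ≤ 1 + ν) : Antitone (xiField ρ ν) := by
  intro v w hvw
  have key : |v| ^ (1 + ν) * Real.sign v ≤ |w| ^ (1 + ν) * Real.sign w := by
    rcases lt_trichotomy v 0 with hv | rfl | hv
    · rcases lt_trichotomy w 0 with hw | rfl | hw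
      · rw [Real.sign_of_neg hv, Real.sign_of_neg hw, abs_of_neg hv, abs_of_neg hw]
        have := Real.rpow_le_rpow (neg_nonneg.2 hw.le) (neg_le_neg hvw) hν
        linarith
      · rw [Real.sign_of_neg hv, Real.sign_zero]
        have : 0 ≤ |v| ^ (1 + ν) := by positivity
        linarith
      · rw [Real.sign_of_neg hv, Real.sign_of_pos hw]
        have h1 : 0 ≤ |v| ^ (1 + ν) := by positivity
        have h2 : 0 ≤ |w| ^ (1 + ν) := by positivity
        linarith
    · rcases hvw.eq_or_lt with rfl | hw
      · exact le_rfl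
      · rw [Real.sign_zero, Real.sign_of_pos hw, mul_zero, mul_one]
        positivity
    · have hw := hv.trans_le hvw
      rw [Real.sign_of_pos hv, Real.sign_of_pos hw, abs_of_pos hv, abs_of_pos hw]
      have := Real.rpow_le_rpow hv.le hvw hν
      linarith
  rw [xiField, xiField, mul_assoc, mul_assoc]
  exact mul_le_mul_of_nonpos_left key (neg_nonpos.2 hρ)

theorem horizon_subset {ξ₀ t : ℝ} (ht : t ∈ horizon ρ ν ξ₀) :
    0 ≤ t ∧ Set.Icc 0 t ⊆ horizon ρ ν ξ₀ := by
  rw [horizon] at ht ⊢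
  split_ifs at ht ⊢
  · exact ⟨ht.1, fun s hs => ⟨hs.1, hs.2.trans_lt ht.2⟩⟩
  · exact ⟨ht, fun s hs => hs.1⟩

theorem exists_gt_mem_horizon {ξ₀ t : ℝ} (ht : t ∈ horizon ρ ν ξ₀) :
    ∃ T ∈ horizon ρ ν ξ₀, t < T := by
  rw [horizon] at ht ⊢
  split_ifs at ht ⊢
  · obtain ⟨T, h1, h2⟩ := exists_between ht.2
    exact ⟨T, ⟨ht.1.trans h1.le, h2⟩, h1⟩
  · exact ⟨t + 1, by simpa using (show (0 : ℝ) ≤ t from ht).trans (by linarith), by linarith⟩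

theorem zero_mem_horizon (hρ : 0 < ρ) {ξ₀ : ℝ} (hξ₀ : ξ₀ ≠ 0) : (0 : ℝ) ∈ horizon ρ ν ξ₀ := by
  rw [horizon]
  split_ifs with hν
  · refine ⟨le_rfl, ?_⟩
    rw [settlingTime]
    have := abs_pos.2 hξ₀
    exact div_pos (by positivity) (mul_pos (neg_pos.2 hν) hρ)
  · exact le_refl (0 : ℝ)

theorem eventually_mem_horizon (hρ : 0 < ρ) {ξ₀ : ℝ} (hξ₀ : ξ₀ ≠ 0) :
    ∀ᶠ t in toHorizon ρ ν ξ₀, t ∈ horizon ρ ν ξ₀ := by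
  have h0 := zero_mem_horizon (ν := ν) hρ hξ₀
  rw [toHorizon]
  rw [horizon] at h0 ⊢
  split_ifs at h0 ⊢
  · filter_upwards [Ioo_mem_nhdsLT h0.2] with t ht
    exact ⟨ht.1.le, ht.2⟩
  · exact eventually_ge_atTop 0

/-- The modulus at time `t` of the solution of `ξ' = -ρ |ξ|^(1+ν) sign ξ` starting at modulus `a`. -/
noncomputable def xiModulus (ρ ν a t : ℝ) : ℝ :=
  if ν = 0 then a * Real.exp (-ρ * t) else (a ^ (-ν) + ν * ρ * t) ^ (-1 / ν)

theorem xiModulus_zero {a : ℝ} (ha : 0 < a) : xiModulus ρ ν a 0 = a := by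
  rw [xiModulus]
  split_ifs with h
  · simp
  · rw [mul_zero, add_zero, ← Real.rpow_mul ha.le, neg_mul, neg_div, mul_neg, neg_neg,
      mul_one_div_cancel h, Real.rpow_one]

theorem xiModulus_base_pos (hρ : 0 < ρ) {ξ₀ : ℝ} (hξ₀ : ξ₀ ≠ 0) {t : ℝ}
    (ht : t ∈ horizon ρ ν ξ₀) : 0 < |ξ₀| ^ (-ν) + ν * ρ * t := by
  have h0 : 0 < |ξ₀| ^ (-ν) := by
    have := abs_pos.2 hξ₀
    positivity
  rw [horizon] at ht
  split_ifs at ht with hν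
  · have h1 := ht.2
    rw [settlingTime, lt_div_iff₀ (mul_pos (neg_pos.2 hν) hρ)] at h1
    linarith
  · have h1 : 0 ≤ ν * ρ * t := mul_nonneg (mul_nonneg (not_lt.1 hν) hρ.le) ht
    linarith

theorem xiModulus_pos (hρ : 0 < ρ) {ξ₀ : ℝ} (hξ₀ : ξ₀ ≠ 0) {t : ℝ}
    (ht : t ∈ horizon ρ ν ξ₀) : 0 < xiModulus ρ ν |ξ₀| t := by
  rw [xiModulus]
  split_ifs
  · exact mul_pos (abs_pos.2 hξ₀) (Real.exp_pos _)
  · exact Real.rpow_pos_of_pos (xiModulus_base_pos hρ hξ₀ ht) _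

theorem hasDerivAt_xiModulus (hρ : 0 < ρ) {ξ₀ : ℝ} (hξ₀ : ξ₀ ≠ 0) {t : ℝ}
    (ht : t ∈ horizon ρ ν ξ₀) :
    HasDerivAt (xiModulus ρ ν |ξ₀|) (-ρ * xiModulus ρ ν |ξ₀| t ^ (1 + ν)) t := by
  by_cases h : ν = 0
  · have e : xiModulus ρ ν |ξ₀| = fun t => |ξ₀| * Real.exp (-ρ * t) := by
      funext t; rw [xiModulus, if_pos h]
    rw [e, h, add_zero, Real.rpow_one]
    have h1 := (((hasDerivAt_id' t).const_mul (-ρ)).exp).const_mul |ξ₀|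
    refine h1.congr_deriv ?_
    ring
  · have e : xiModulus ρ ν |ξ₀| = fun t => (|ξ₀| ^ (-ν) + ν * ρ * t) ^ (-1 / ν) := by
      funext t; rw [xiModulus, if_neg h]
    have hb := xiModulus_base_pos hρ hξ₀ ht
    rw [e]
    have h1 := (((hasDerivAt_id' t).const_mul (ν * ρ)).const_add (|ξ₀| ^ (-ν))).rpow_const
      (p := -1 / ν) (Or.inl hb.ne')
    refine h1.congr_deriv ?_
    rw [← Real.rpow_mul hb.le, show -1 / ν * (1 + ν) = -1 / ν - 1 by field_simp; ring]
    field_simp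

theorem tendsto_xiModulus (hρ : 0 < ρ) (ξ₀ : ℝ) :
    Tendsto (xiModulus ρ ν |ξ₀|) (toHorizon ρ ν ξ₀) (𝓝 0) := by
  by_cases h : ν = 0
  · have e : xiModulus ρ ν |ξ₀| = fun t => |ξ₀| * Real.exp (-ρ * t) := by
      funext t; rw [xiModulus, if_pos h]
    rw [e, toHorizon, if_neg (by simp [h])]
    have h1 := (Real.tendsto_exp_atBot.comp
      (tendsto_id.const_mul_atTop_of_neg (neg_neg_of_pos hρ))).const_mul |ξ₀|
    simpa [Function.comp_def] using h1
  · have e : xiModulus ρ ν |ξ₀| = fun t => (|ξ₀| ^ (-ν) + ν * ρ * t) ^ (-1 / ν) := by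
      funext t; rw [xiModulus, if_neg h]
    rw [e, toHorizon]
    split_ifs with hν
    · have hp : 0 < -1 / ν := div_pos_of_neg_of_neg (by norm_num) hν
      have hz : |ξ₀| ^ (-ν) + ν * ρ * settlingTime ρ ν ξ₀ = 0 := by
        rw [settlingTime]
        field_simp
        ring
      -- The base vanishes at the settling time, but the exponent -1/ν is positive, so the power
      -- remains continuous there.
      have h1 : ContinuousAt (fun t => (|ξ₀| ^ (-ν) + ν * ρ * t) ^ (-1 / ν))
          (settlingTime ρ ν ξ₀) :=
        ContinuousAt.rpow_const (by fun_prop) (Or.inr hp.le)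
      have h2 := h1.tendsto
      rw [hz, Real.zero_rpow hp.ne'] at h2
      exact h2.mono_left nhdsWithin_le_nhds
    · have hν' : 0 < ν := lt_of_le_of_ne (not_lt.1 hν) (Ne.symm h)
      have h1 : Tendsto (fun t => |ξ₀| ^ (-ν) + ν * ρ * t) atTop atTop :=
        tendsto_atTop_add_const_left _ _ (tendsto_id.const_mul_atTop (mul_pos hν' hρ))
      have h2 := (tendsto_rpow_neg_atTop (one_div_pos.2 hν')).comp h1
      simpa only [Function.comp_def, neg_div] using h2

theorem abs_sign_mul {ξ₀ r : ℝ} (hξ₀ : ξ₀ ≠ 0) (hr : 0 < r) : |Real.sign ξ₀ * r| = r := by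
  rcases hξ₀.lt_or_gt with h | h
  · rw [Real.sign_of_neg h, neg_one_mul, abs_neg, abs_of_pos hr]
  · rw [Real.sign_of_pos h, one_mul, abs_of_pos hr]

theorem sign_sign_mul {ξ₀ r : ℝ} (hr : 0 < r) : Real.sign (Real.sign ξ₀ * r) = Real.sign ξ₀ := by
  rw [mul_comm, sign_pos_mul hr]
  rcases lt_trichotomy ξ₀ 0 with h | rfl | h
  · rw [Real.sign_of_neg h, Real.sign_of_neg (by norm_num)]
  · rw [Real.sign_zero, Real.sign_zero]
  · rw [Real.sign_of_pos h, Real.sign_of_pos one_pos]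

theorem continuousOn_xiModulus (hρ : 0 < ρ) {ξ₀ : ℝ} (hξ₀ : ξ₀ ≠ 0) :
    ContinuousOn (xiModulus ρ ν |ξ₀|) (horizon ρ ν ξ₀) := fun _ ht =>
  (hasDerivAt_xiModulus hρ hξ₀ ht).continuousAt.continuousWithinAt

theorem isSolutionOn_xiModulus (hρ : 0 < ρ) {ξ₀ : ℝ} (hξ₀ : ξ₀ ≠ 0) :
    IsSolutionOn (horizon ρ ν ξ₀) (fun _ => xiField ρ ν)
      (fun t => Real.sign ξ₀ * xiModulus ρ ν |ξ₀| t) := by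
  have e : ∀ t ∈ horizon ρ ν ξ₀, xiField ρ ν (Real.sign ξ₀ * xiModulus ρ ν |ξ₀| t) =
      Real.sign ξ₀ * (-ρ * xiModulus ρ ν |ξ₀| t ^ (1 + ν)) := fun t ht => by
    have hr := xiModulus_pos hρ hξ₀ ht
    rw [xiField, abs_sign_mul hξ₀ hr, sign_sign_mul hr]
    ring
  refine isSolutionOn_of_hasDerivAt (fun t ht => horizon_subset ht) (fun t ht => ?_) ?_
  · rw [e t ht]
    exact (hasDerivAt_xiModulus hρ hξ₀ ht).const_mul _
  · refine ContinuousOn.congr ?_ e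
    exact continuousOn_const.mul (continuousOn_const.mul
      ((continuousOn_xiModulus hρ hξ₀).rpow_const fun t ht =>
        Or.inl (xiModulus_pos hρ hξ₀ ht).ne'))

/-- Comparison in both directions with the explicit solution. In particular ξ keeps its sign and
does not vanish before T₀, so the gain is well behaved there. -/
theorem IsSolutionOn.eq_xiModulus (hρ : 0 < ρ) (hν : 0 ≤ 1 + ν) {ξ₀ : ℝ} (hξ₀ : ξ₀ ≠ 0)
    {ξ : ℝ → ℝ} (hξ : IsSolutionOn (horizon ρ ν ξ₀) (fun _ => xiField ρ ν) ξ) (h0 : ξ 0 = ξ₀)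
    {t : ℝ} (ht : t ∈ horizon ρ ν ξ₀) : ξ t = Real.sign ξ₀ * xiModulus ρ ν |ξ₀| t := by
  have hX := isSolutionOn_xiModulus (ν := ν) hρ hξ₀
  have e : ξ 0 = Real.sign ξ₀ * xiModulus ρ ν |ξ₀| 0 := by
    rw [h0, xiModulus_zero (abs_pos.2 hξ₀)]
    rcases hξ₀.lt_or_gt with h | h
    · rw [Real.sign_of_neg h, abs_of_neg h]; ring
    · rw [Real.sign_of_pos h, abs_of_pos h]; ring
  have hf := antitone_xiField hρ.le hν
  exact le_antisymm (hξ.le_of_antitone hf (fun t ht => horizon_subset ht) hX e ht)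
    (hX.le_of_antitone hf (fun t ht => horizon_subset ht) hξ e.symm ht)

end ScalarEquation

/-! ### Error dynamics, existence and convergence of the observer. -/

section Observer

variable {n m k : ℕ}

/-- Since A + L₀C = A₀, the observer field splits into the plant field and a linear error field. The
input drops out of the error, so plant and error solutions can be added or subtracted as integral
equations. -/
theorem observer_field_add {A : Matrix (Fin n) (Fin n) ℝ} {C : Matrix (Fin k) (Fin n) ℝ}
    (G₀ : Matrix (Fin n) (Fin n) ℝ) (Y₀ : Matrix (Fin n) (Fin k) ℝ)
    (g : Matrix (Fin n) (Fin k) ℝ) (b x e : Fin n → ℝ) :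
    A *ᵥ (x + e) + b + (gainL₀ G₀ Y₀ + g) *ᵥ (C *ᵥ (x + e) - C *ᵥ x) =
      (A *ᵥ x + b) + (matA₀ A C G₀ Y₀ + g * C) *ᵥ e := by
  have h : matA₀ A C G₀ Y₀ = A + gainL₀ G₀ Y₀ * C := by
    rw [matA₀, gainL₀, Matrix.neg_mul, sub_eq_add_neg]
  rw [h, mulVec_add A, mulVec_add C, add_sub_cancel_left, mulVec_mulVec, Matrix.add_mul, add_mulVec _ _ e,
    add_mulVec _ _ e, add_mulVec _ _ e]
  abel

variable {A : Matrix (Fin n) (Fin n) ℝ} {B : Matrix (Fin n) (Fin m) ℝ}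
  {C : Matrix (Fin k) (Fin n) ℝ} {G₀ : Matrix (Fin n) (Fin n) ℝ} {Y₀ : Matrix (Fin n) (Fin k) ℝ}
  {G : Matrix (Fin n) (Fin n) ℝ} {L : Matrix (Fin n) (Fin k) ℝ} {ρ ν : ℝ} {J : Set ℝ}
  {u : ℝ → Fin m → ℝ} {x : ℝ → Fin n → ℝ} {ξ : ℝ → ℝ}

theorem IsPlantSolution.add_error (hx : IsPlantSolution A B J u x) {ε : ℝ → Fin n → ℝ}
    (hε : IsSolutionOn J (fun t v => (matA₀ A C G₀ Y₀ + gain G L ν (ξ t) * C) *ᵥ v) ε) :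
    IsSolutionOn J (fun t v => A *ᵥ v + B *ᵥ u t +
      (gainL₀ G₀ Y₀ + gain G L ν (ξ t)) *ᵥ (C *ᵥ v - C *ᵥ x t)) (fun t => x t + ε t) := by
  intro t ht
  obtain ⟨i1, e1⟩ := hx t ht
  obtain ⟨i2, e2⟩ := hε t ht
  simp only [observer_field_add]
  refine ⟨i1.add i2, ?_⟩
  rw [intervalIntegral.integral_add i1 i2]
  rw [e1, e2]
  abel

theorem IsPlantSolution.sub_isSolutionOn (hx : IsPlantSolution A B J u x) {z : ℝ → Fin n → ℝ}
    (hz : IsSolutionOn J (fun t v => A *ᵥ v + B *ᵥ u t +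
      (gainL₀ G₀ Y₀ + gain G L ν (ξ t)) *ᵥ (C *ᵥ v - C *ᵥ x t)) z) :
    IsSolutionOn J (fun t v => (matA₀ A C G₀ Y₀ + gain G L ν (ξ t) * C) *ᵥ v)
      (fun t => z t - x t) := by
  intro t ht
  obtain ⟨i1, e1⟩ := hx t ht
  obtain ⟨i2, e2⟩ := hz t ht
  have e : ∀ s, (matA₀ A C G₀ Y₀ + gain G L ν (ξ s) * C) *ᵥ (z s - x s) =
      (A *ᵥ z s + B *ᵥ u s + (gainL₀ G₀ Y₀ + gain G L ν (ξ s)) *ᵥ (C *ᵥ z s - C *ᵥ x s)) -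
      (A *ᵥ x s + B *ᵥ u s) := fun s => by
    have h := observer_field_add (A := A) (C := C) G₀ Y₀ (gain G L ν (ξ s)) (B *ᵥ u s) (x s)
      (z s - x s)
    rw [add_sub_cancel] at h
    rw [h, add_sub_cancel_left]
  simp only [e]
  refine ⟨i2.sub i1, ?_⟩
  rw [intervalIntegral.integral_sub i2 i1]
  rw [e1, e2]
  abel

variable {A₀ : Matrix (Fin n) (Fin n) ℝ} {ξ₀ : ℝ}

theorem hasDerivAt_log_xiModulus (hρ : 0 < ρ) (hξ₀ : ξ₀ ≠ 0) {t : ℝ}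
    (ht : t ∈ horizon ρ ν ξ₀) :
    HasDerivAt (fun t => Real.log (xiModulus ρ ν |ξ₀| t)) (-ρ * xiModulus ρ ν |ξ₀| t ^ ν) t := by
  have hr := xiModulus_pos hρ hξ₀ ht
  refine ((hasDerivAt_xiModulus hρ hξ₀ ht).log hr.ne').congr_deriv ?_
  rw [add_comm, Real.rpow_add_one hr.ne', ← mul_assoc, mul_div_cancel_right₀ _ hr.ne']

theorem continuousOn_errorMatrix (hρ : 0 < ρ) (hξ₀ : ξ₀ ≠ 0)
    (hξ : ∀ t ∈ horizon ρ ν ξ₀, ξ t = Real.sign ξ₀ * xiModulus ρ ν |ξ₀| t) :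
    ContinuousOn (fun t => A₀ + gain G L ν (ξ t) * C) (horizon ρ ν ξ₀) := by
  have h1 : ContinuousOn ξ (horizon ρ ν ξ₀) :=
    (continuousOn_const.mul (continuousOn_xiModulus hρ hξ₀)).congr hξ
  have h2 : ∀ t ∈ horizon ρ ν ξ₀, ξ t ≠ 0 := fun t ht => by
    have hr := xiModulus_pos hρ hξ₀ ht
    rw [← abs_pos, hξ t ht, abs_sign_mul hξ₀ hr]
    exact hr
  exact continuousOn_const.add ((Continuous.matrix_mul continuous_id continuous_const).comp_continuousOn
    (continuousOn_gain G L ν h1 h2))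

theorem errorMatrix_mulVec_expGroup (hA : A₀ * G = (G + ν • 1) * A₀) (hC : C * G = C)
    (hρ : 0 < ρ) (hξ₀ : ξ₀ ≠ 0)
    (hξ : ∀ t ∈ horizon ρ ν ξ₀, ξ t = Real.sign ξ₀ * xiModulus ρ ν |ξ₀| t)
    {t : ℝ} (ht : t ∈ horizon ρ ν ξ₀) (w : Fin n → ℝ) :
    (A₀ + gain G L ν (ξ t) * C) *ᵥ (expGroup G (Real.log (xiModulus ρ ν |ξ₀| t)) *ᵥ w) =
      xiModulus ρ ν |ξ₀| t ^ ν •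
        (expGroup G (Real.log (xiModulus ρ ν |ξ₀| t)) *ᵥ ((A₀ + L * C) *ᵥ w)) := by
  have hr := xiModulus_pos hρ hξ₀ ht
  have habs : |ξ t| = xiModulus ρ ν |ξ₀| t := by rw [hξ t ht, abs_sign_mul hξ₀ hr]
  have hne : ξ t ≠ 0 := by rw [← abs_pos, habs]; exact hr
  have h := errorMatrix_mul_expGroup hA hC L hne
  rw [habs] at h
  rw [mulVec_mulVec, h, smul_mulVec, ← mulVec_mulVec]

theorem exists_error_solution (hA : A₀ * G = (G + ν • 1) * A₀) (hC : C * G = C)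
    (hρ : 0 < ρ) (hξ₀ : ξ₀ ≠ 0)
    (hξ : ∀ t ∈ horizon ρ ν ξ₀, ξ t = Real.sign ξ₀ * xiModulus ρ ν |ξ₀| t) (ε₀ : Fin n → ℝ) :
    ∃ ε : ℝ → Fin n → ℝ, ε 0 = ε₀ ∧
      IsSolutionOn (horizon ρ ν ξ₀) (fun t v => (A₀ + gain G L ν (ξ t) * C) *ᵥ v) ε := by
  set σ : ℝ → ℝ := fun t => Real.log (xiModulus ρ ν |ξ₀| t) with hσ
  -- With σ = ln r and σ' = -ρr^ν, the substitution ε = d(σ)w gives w' = r^ν M w. The new time (σ(0)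
  -- - σ(t))/ρ has derivative r^ν, so w is a matrix exponential in it.
  set M : Matrix (Fin n) (Fin n) ℝ := A₀ + L * C + ρ • G with hM
  set w : ℝ → Fin n → ℝ := fun t =>
    expGroup M ((σ 0 - σ t) / ρ) *ᵥ (expGroup G (-σ 0) *ᵥ ε₀) with hw
  have hd : ∀ t ∈ horizon ρ ν ξ₀, HasDerivAt (fun t => expGroup G (σ t) *ᵥ w t)
      ((A₀ + gain G L ν (ξ t) * C) *ᵥ (expGroup G (σ t) *ᵥ w t)) t := fun t ht => by
    have h1 := hasDerivAt_log_xiModulus hρ hξ₀ ht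
    have h2 := HasDerivAt.expGroup_mulVec M ((h1.const_sub (σ 0)).div_const ρ)
      (hasDerivAt_const t (expGroup G (-σ 0) *ᵥ ε₀))
    have h3 := HasDerivAt.expGroup_mulVec G h1 h2
    refine h3.congr_deriv ?_
    rw [errorMatrix_mulVec_expGroup hA hC hρ hξ₀ hξ ht]
    have hcomm : ∀ v, G *ᵥ (expGroup G (σ t) *ᵥ v) = expGroup G (σ t) *ᵥ (G *ᵥ v) := fun v => by
      rw [mulVec_mulVec, mulVec_mulVec, (SemiconjBy.expGroup (Commute.refl G) (σ t)).eq]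
    change (-ρ * xiModulus ρ ν |ξ₀| t ^ ν) • (G *ᵥ (expGroup G (σ t) *ᵥ w t)) +
      expGroup G (σ t) *ᵥ ((-(-ρ * xiModulus ρ ν |ξ₀| t ^ ν) / ρ) • (M *ᵥ w t) +
        expGroup M ((σ 0 - σ t) / ρ) *ᵥ 0) = _
    have e : -(-ρ * xiModulus ρ ν |ξ₀| t ^ ν) / ρ = xiModulus ρ ν |ξ₀| t ^ ν := by
      field_simp
    rw [hcomm, e, mulVec_zero, add_zero, mulVec_smul, hM, add_mulVec _ _ (w t), mulVec_add,
      smul_mulVec, mulVec_smul]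
    module
  refine ⟨fun t => expGroup G (σ t) *ᵥ w t, ?_, ?_⟩
  · simp only [hw]
    rw [sub_self, zero_div, expGroup_zero, one_mulVec, mulVec_mulVec, expGroup_mul_expGroup_neg,
      one_mulVec]
  · refine isSolutionOn_of_hasDerivAt (fun t ht => horizon_subset ht) hd fun t ht => ?_
    exact (Continuous.matrix_mulVec continuous_fst continuous_snd).comp_continuousOn
      ((continuousOn_errorMatrix hρ hξ₀ hξ).prodMk fun s hs =>
        (hd s hs).continuousAt.continuousWithinAt) t ht

/-- With L = P⁻¹Y one has PL = Y, and the matrix inequality becomes a Lyapunov inequality for A₀ +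
LC + ρG. -/
theorem SolvesLMI.closedLoop_nonpos {P : Matrix (Fin n) (Fin n) ℝ} {Y : Matrix (Fin n) (Fin k) ℝ}
    (h : SolvesLMI A₀ C G ρ P Y) (x : Fin n → ℝ) :
    x ⬝ᵥ (P *ᵥ ((A₀ + P⁻¹ * Y * C + ρ • G) *ᵥ x)) ≤ 0 := by
  have hPT := transpose_eq_of_posDef h.posDef
  have hdet : IsUnit P.det := (isUnit_iff_isUnit_det _).1 h.posDef.isUnit
  have hY : P * (P⁻¹ * Y * C) = Y * C := by
    rw [Matrix.mul_assoc, mul_nonsing_inv_cancel_left _ _ hdet]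
  have h1 := h.lmi.dotProduct_mulVec_nonneg x
  have e : P * A₀ + A₀ᵀ * P + Y * C + Cᵀ * Yᵀ + ρ • (P * G + Gᵀ * P) =
      P * (A₀ + P⁻¹ * Y * C + ρ • G) + (A₀ + P⁻¹ * Y * C + ρ • G)ᵀ * P := by
    have hY' : (P⁻¹ * Y * C)ᵀ * P = Cᵀ * Yᵀ := by
      rw [← transpose_mul Y C, ← hY, transpose_mul P, hPT]
    rw [mul_add, mul_add, hY, transpose_add, transpose_add, add_mul, add_mul, hY', transpose_smul,
      mul_smul_comm, smul_mul_assoc, smul_add]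
    abel
  rw [e, neg_mulVec, dotProduct_neg, star_trivial, dotProduct_lyapunov hPT] at h1
  linarith

theorem tendsto_error (hA : A₀ * G = (G + ν • 1) * A₀) (hC : C * G = C)
    (hρ : 0 < ρ) (hξ₀ : ξ₀ ≠ 0)
    (hξ : ∀ t ∈ horizon ρ ν ξ₀, ξ t = Real.sign ξ₀ * xiModulus ρ ν |ξ₀| t)
    {P : Matrix (Fin n) (Fin n) ℝ} {Y : Matrix (Fin n) (Fin k) ℝ}
    (hPY : SolvesLMI A₀ C G ρ P Y) {ε : ℝ → Fin n → ℝ}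
    (hε : IsSolutionOn (horizon ρ ν ξ₀)
      (fun t v => (A₀ + gain G (P⁻¹ * Y) ν (ξ t) * C) *ᵥ v) ε) :
    Tendsto ε (toHorizon ρ ν ξ₀) (𝓝 0) := by
  have hPT := transpose_eq_of_posDef hPY.posDef
  set σ : ℝ → ℝ := fun t => Real.log (xiModulus ρ ν |ξ₀| t) with hσ
  set w : ℝ → Fin n → ℝ := fun t => expGroup G (-σ t) *ᵥ ε t with hw
  have hεw : ∀ t, ε t = expGroup G (σ t) *ᵥ w t := fun t => by
    simp only [hw]
    rw [mulVec_mulVec, expGroup_mul_expGroup_neg, one_mulVec]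
  have hσc : ContinuousOn σ (horizon ρ ν ξ₀) := fun t ht =>
    (hasDerivAt_log_xiModulus hρ hξ₀ ht).continuousAt.continuousWithinAt
  -- In the dilated variable the dynamics are r^ν ≥ 0 times a fixed linear field along which the
  -- form of `P` does not increase.
  have hV : ∀ t ∈ horizon ρ ν ξ₀, w t ⬝ᵥ (P *ᵥ w t) ≤ w 0 ⬝ᵥ (P *ᵥ w 0) := by
    intro t ht
    obtain ⟨T, hT, htT⟩ := exists_gt_mem_horizon ht
    obtain ⟨hT0, hTJ⟩ := horizon_subset hT
    have ht0 := (horizon_subset ht).1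
    have hεc := hε.continuousOn hT0 hTJ
    have hfc : ContinuousOn (fun s => (A₀ + gain G (P⁻¹ * Y) ν (ξ s) * C) *ᵥ ε s)
        (Set.Icc 0 T) :=
      (Continuous.matrix_mulVec continuous_fst continuous_snd).comp_continuousOn
        (((continuousOn_errorMatrix hρ hξ₀ hξ).mono hTJ).prodMk hεc)
    have hwc : ContinuousOn w (Set.Icc 0 T) :=
      (Continuous.matrix_mulVec continuous_fst continuous_snd).comp_continuousOn
        (((continuous_expGroup G).comp_continuousOn (hσc.mono hTJ).neg).prodMk hεc)
    have hwd : ∀ s ∈ Set.Ioo 0 T, HasDerivAt w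
        (xiModulus ρ ν |ξ₀| s ^ ν • ((A₀ + P⁻¹ * Y * C + ρ • G) *ᵥ w s)) s := by
      intro s hs
      have hsJ := hTJ ⟨hs.1.le, hs.2.le⟩
      have h1 := HasDerivAt.expGroup_mulVec G (hasDerivAt_log_xiModulus hρ hξ₀ hsJ).neg
        (hε.hasDerivAt hTJ hfc hs)
      refine h1.congr_deriv ?_
      change (-(-ρ * xiModulus ρ ν |ξ₀| s ^ ν)) • (G *ᵥ w s) + expGroup G (-σ s) *ᵥ
        ((A₀ + gain G (P⁻¹ * Y) ν (ξ s) * C) *ᵥ ε s) = _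
      have hinv : expGroup G (-σ s) * expGroup G (σ s) = 1 := by
        simpa using expGroup_mul_expGroup_neg G (-σ s)
      rw [hεw s, errorMatrix_mulVec_expGroup hA hC hρ hξ₀ hξ hsJ, mulVec_smul,
        mulVec_mulVec _ (expGroup G (-σ s)), hinv, one_mulVec, add_mulVec _ (ρ • G) (w s),
        smul_mulVec]
      module
    have hanti : AntitoneOn (fun s => w s ⬝ᵥ (P *ᵥ w s)) (Set.Icc 0 T) := by
      refine antitoneOn_of_deriv_nonpos (convex_Icc 0 T)
        ((continuous_quadraticForm P).comp_continuousOn hwc) ?_ ?_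
      · rw [interior_Icc]
        exact fun s hs => ((hwd s hs).quadraticForm hPT).differentiableAt.differentiableWithinAt
      · rw [interior_Icc]
        intro s hs
        rw [((hwd s hs).quadraticForm hPT).deriv, mulVec_smul, dotProduct_smul, smul_eq_mul]
        have hr := xiModulus_pos hρ hξ₀ (hTJ ⟨hs.1.le, hs.2.le⟩)
        have h1 := mul_nonpos_of_nonneg_of_nonpos (Real.rpow_nonneg hr.le ν)
          (hPY.closedLoop_nonpos (w s))
        linarith
    exact hanti ⟨le_rfl, hT0⟩ ⟨ht0, htT.le⟩ ht0
  obtain ⟨c, hc, b, hb⟩ := exists_sq_norm_expGroup_le hPY.posDef hPY.monotone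
  have hJ := eventually_mem_horizon (ν := ν) hρ hξ₀
  -- As r → 0 the dilation parameter ln r tends to -∞. The uniform contraction estimate then applies
  -- to the moving vector w t, since it depends on w only through the bounded value wᵀPw.
  have hσt : Tendsto σ (toHorizon ρ ν ξ₀) atBot := by
    refine Real.tendsto_log_nhdsGT_zero.comp (tendsto_nhdsWithin_iff.2
      ⟨tendsto_xiModulus hρ ξ₀, hJ.mono fun t ht => xiModulus_pos hρ hξ₀ ht⟩)
  -- The contraction estimate leaves the sign of b open. Passing to |b| allows w t to be replaced by
  -- w 0 inside the bound.
  have h1 : Tendsto (fun t => |b| * Real.exp (c * σ t) * (w 0 ⬝ᵥ (P *ᵥ w 0)))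
      (toHorizon ρ ν ξ₀) (𝓝 0) := by
    have := (((Real.tendsto_exp_atBot.comp (hσt.const_mul_atBot hc)).const_mul |b|).mul_const
      (w 0 ⬝ᵥ (P *ᵥ w 0)))
    simpa [Function.comp_def] using this
  have h2 : Tendsto (fun t => ‖ε t‖ ^ 2) (toHorizon ρ ν ξ₀) (𝓝 0) := by
    refine tendsto_of_tendsto_of_tendsto_of_le_of_le' tendsto_const_nhds h1
      (Eventually.of_forall fun t => by positivity) ?_
    filter_upwards [hJ, hσt.eventually_le_atBot 0] with t ht hσ0
    have h3 := hb (w t) (σ t) hσ0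
    rw [← hεw] at h3
    have hVn : 0 ≤ w t ⬝ᵥ (P *ᵥ w t) := by
      simpa using hPY.posDef.posSemidef.dotProduct_mulVec_nonneg (w t)
    calc _ ≤ b * Real.exp (c * σ t) * (w t ⬝ᵥ (P *ᵥ w t)) := h3
      _ ≤ |b| * Real.exp (c * σ t) * (w t ⬝ᵥ (P *ᵥ w t)) := by
        gcongr
        exact le_abs_self b
      _ ≤ _ := mul_le_mul_of_nonneg_left (hV t ht) (by positivity)
  have h3 := h2.sqrt
  simp only [Real.sqrt_sq (norm_nonneg _), Real.sqrt_zero] at h3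
  exact tendsto_zero_iff_norm_tendsto_zero.2 h3

end Observer

/-! ### The four claims combined. -/

theorem theorem2 {n m k : ℕ} (A : Matrix (Fin n) (Fin n) ℝ) (B : Matrix (Fin n) (Fin m) ℝ)
    (C : Matrix (Fin k) (Fin n) ℝ) (hobs : ObservablePair A C) (N : ℕ) (hN : IsObsIndex A C N) :
    -- 1) solvability of the algebraic equation, with properties a) and b)
    (∃ (G₀ : Matrix (Fin n) (Fin n) ℝ) (Y₀ : Matrix (Fin n) (Fin k) ℝ),
      IsHomogenizing A C N G₀ Y₀) ∧
    -- 2), 3), 4) for every such solution and every admissible degree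
    (∀ (G₀ : Matrix (Fin n) (Fin n) ℝ) (Y₀ : Matrix (Fin n) (Fin k) ℝ),
      IsHomogenizing A C N G₀ Y₀ → ∀ ν : ℝ, -1 / (N : ℝ) ≤ ν → ∀ ρ : ℝ, 0 < ρ →
      -- 2) feasibility of the linear matrix inequality
      (∃ (P : Matrix (Fin n) (Fin n) ℝ) (Y : Matrix (Fin n) (Fin k) ℝ),
        SolvesLMI (matA₀ A C G₀ Y₀) C (genD G₀ ν) ρ P Y) ∧
      -- 3) homogeneity of the error equation
      (IsDilation (expGroup (genD G₀ ν)) ∧ IsDilation (extGroup (genD G₀ ν)) ∧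
        ∀ L : Matrix (Fin n) (Fin k) ℝ,
          IsHomogeneousOn (extGroup (genD G₀ ν))
            (errorField (matA₀ A C G₀ Y₀) C (genD G₀ ν) L ρ ν) ν
            {e | e (Sum.inr ()) ≠ 0}) ∧
      -- 4) existence on `[0, T₀)` and convergence at `T₀`
      (∀ (P : Matrix (Fin n) (Fin n) ℝ) (Y : Matrix (Fin n) (Fin k) ℝ),
        SolvesLMI (matA₀ A C G₀ Y₀) C (genD G₀ ν) ρ P Y →
        ∀ ξ₀ : ℝ, ξ₀ ≠ 0 → ∀ (u : ℝ → Fin m → ℝ) (x : ℝ → Fin n → ℝ),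
        IsPlantSolution A B (horizon ρ ν ξ₀) u x →
        (∀ z₀ : Fin n → ℝ, ∃ (z : ℝ → Fin n → ℝ) (ξ : ℝ → ℝ), z 0 = z₀ ∧ ξ 0 = ξ₀ ∧
          IsObserverSolution A B C (genD G₀ ν) (gainL₀ G₀ Y₀) (P⁻¹ * Y) ρ ν (horizon ρ ν ξ₀)
            u (fun t => C *ᵥ x t) z ξ) ∧
        (∀ (z : ℝ → Fin n → ℝ) (ξ : ℝ → ℝ), ξ 0 = ξ₀ →
          IsObserverSolution A B C (genD G₀ ν) (gainL₀ G₀ Y₀) (P⁻¹ * Y) ρ ν (horizon ρ ν ξ₀)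
            u (fun t => C *ᵥ x t) z ξ →
          Tendsto (fun t => (z t - x t, ξ t)) (toHorizon ρ ν ξ₀) (𝓝 (0, 0))))) := by
  have hN1 : 1 ≤ N := hN.1.1
  refine ⟨exists_isHomogenizing hN, fun G₀ Y₀ h ν hν ρ hρ => ?_⟩
  have hLMI := h.exists_solvesLMI hN1 hN.1.2 hν hρ
  -- From N ≥ 1 one gets ν ≥ -1, which the monotonicity of the ξ-field requires.
  have hν1 : 0 ≤ 1 + ν := by
    have h1 : (1 : ℝ) ≤ N := by exact_mod_cast hN1
    have h2 : -1 ≤ -1 / (N : ℝ) := by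
      rw [le_div_iff₀ (by linarith)]
      linarith
    linarith
  have hA := h.homA₀ ν
  have hC := h.homC ν
  refine ⟨hLMI, ?_, ?_⟩
  · obtain ⟨P, Y, hPY⟩ := hLMI
    have hdil := isDilation_expGroup hPY.posDef hPY.monotone
    exact ⟨hdil, isDilation_extGroup hdil, fun L => isHomogeneousOn_errorField hA hC L ρ⟩
  · intro P Y hPY ξ₀ hξ₀ u x hx
    refine ⟨fun z₀ => ?_, fun z ξ hξ0 hz => ?_⟩
    · have hX := isSolutionOn_xiModulus (ν := ν) hρ hξ₀
      -- The observer state is obtained as the plant state plus an error solution, so no existence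
      -- theorem for an equation driven by a merely integrable input is needed.
      obtain ⟨ε, hε0, hε⟩ := exists_error_solution (L := P⁻¹ * Y) hA hC hρ hξ₀
        (ξ := fun t => Real.sign ξ₀ * xiModulus ρ ν |ξ₀| t) (fun _ _ => rfl) (z₀ - x 0)
      refine ⟨fun t => x t + ε t, _, ?_, ?_, hx.add_error hε, hX⟩
      · dsimp only
        rw [hε0, add_sub_cancel]
      · rw [xiModulus_zero (abs_pos.2 hξ₀)]
        rcases hξ₀.lt_or_gt with h0 | h0
        · rw [Real.sign_of_neg h0, abs_of_neg h0, neg_one_mul, neg_neg]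
        · rw [Real.sign_of_pos h0, abs_of_pos h0, one_mul]
    · have hξ : ∀ t ∈ horizon ρ ν ξ₀, ξ t = Real.sign ξ₀ * xiModulus ρ ν |ξ₀| t :=
        fun t ht => hz.2.eq_xiModulus hρ hν1 hξ₀ hξ0 ht
      refine (tendsto_error hA hC hρ hξ₀ hξ hPY (hx.sub_isSolutionOn hz.1)).prodMk_nhds ?_
      have h1 := (tendsto_xiModulus (ν := ν) hρ ξ₀).const_mul (Real.sign ξ₀)
      rw [mul_zero] at h1
      refine h1.congr' ?_
      filter_upwards [eventually_mem_horizon hρ hξ₀] with t ht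
      exact (hξ t ht).symm
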